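/- Let $\mathfrak{g}=\mathfrak{sl}(2,\mathbb{C})$ with root vector $x_\alpha$ (the upper triangular matrix unit) and invariant form $\langle a,b\rangle=\operatorname{tr}(ab)$, and let $\widehat{\mathfrak{g}}=\mathfrak{g}\otimes\mathbb{C}[t,t^{-1}]\oplus\mathbb{C}\mathbf{k}$ be the affine Lie algebra, with $\mathbf{k}$ central and $[a\otimes t^m,b\otimes t^n]=[a,b]\otimes t^{m+n}+m\langle a,b\rangle\delta_{m+n,0}\mathbf{k}$. Let $N(\Lambda_0)$ be the generalized Verma module, i.e. the $\widehat{\mathfrak{g}}$-module induced from the one-dimensional module $\mathbb{C}v^N_{\Lambda_0}$ of $\mathfrak{g}\otimes\mathbb{C}[t]\oplus\mathbb{C}\mathbf{k}$ on which $\mathfrak{g}\otimes\mathbb{C}[t]$ acts by $0$ and $\mathbf{k}$ acts by $1$, with its natural vertex algebra structure: the vacuum is $v^N_{\Lambda_0}$ and $Y(a(-1)v^N_{\Lambda_0},x)=\sum_{m\in\mathbb{Z}}a(m)x^{-m-1}$ for $a\in\mathfrak{g}$, where $a(m)$ denotes the action of $a\otimes t^m$. Put $\bar{\mathfrak{n}}=\mathbb{C}x_\alpha\otimes\mathbb{C}[t,t^{-1}]$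 and $\bar{\mathfrak{n}}_-=\mathbb{C}x_\alpha\otimes t^{-1}\mathbb{C}[t^{-1}]$, and let $W^N(\Lambda_0)=U(\bar{\mathfrak{n}})\cdot v^N_{\Lambda_0}\subset N(\Lambda_0)$ be the principal subspace, which is a vertex subalgebra of $N(\Lambda_0)$. For $t\ge 2$ let $$R_t^0=\sum_{m_1,m_2\le -1,\ m_1+m_2=-t}x_\alpha(m_1)x_\alpha(m_2)\in U(\bar{\mathfrak{n}}_-),\qquad I_{\Lambda_0}=\sum_{t\ge 2}U(\bar{\mathfrak{n}}_-)R_t^0 .$$ An ideal of a vertex algebra $V$ is a subspace $I$ such that $v_nw\in I$ and $w_nv\in I$ for all $v\in V$, $w\in I$, $n\in\mathbb{Z}$; the ideal generated by an element is the smallest ideal containing it. Then the subspace $I_{\Lambda_0}\cdot v^N_{\Lambda_0}$ is the ideal of the vertex algebra $W^N(\Lambda_0)$ generated by $x_\alpha(-1)^2\cdot v^N_{\Lambda_0}$. -/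

import Mathlib

noncomputable section

namespace VA

/-- The coefficient `(-1)^i * binom(n, i)` of `t^(n-i) x^i` in the expansion of `(t - x)^n`
in nonnegative powers of `x`, for any integer `n`. -/
def bc (n : ℤ) (i : ℕ) : ℤ := (-1) ^ i * Ring.choose n i

lemma bc_zero (n : ℤ) : bc n 0 = 1 := by simp [bc]

lemma bc_succ (n : ℤ) (i : ℕ) : bc (n + 1) (i + 1) = bc n (i + 1) - bc n i := by
  simp only [bc, Ring.choose_succ_succ]; ring

lemma succ_mul_choose (n : ℤ) (i : ℕ) :
    ((i : ℤ) + 1) * Ring.choose n (i + 1) = (n - i) * Ring.choose n i := by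
  have := Ring.choose_add_smul_choose n i 1
  have h1 := Ring.choose_smul_choose n (n := i + 1) (k := i) (by omega)
  simp at this h1
  linarith

lemma bc_mul (n : ℤ) (i : ℕ) : bc n i * (n - i) = -(((i : ℤ) + 1) * bc n (i + 1)) := by
  have := succ_mul_choose n i
  simp only [bc, pow_succ]
  linear_combination (-1) ^ i * (-this)

lemma choose_mul_sub (n : ℤ) (i : ℕ) :
    (n - i) * Ring.choose n i = n * Ring.choose (n - 1) i := by
  induction i with
  | zero => simp
  | succ i ih =>
    have h1 := succ_mul_choose n i
    have h2 := succ_mul_choose (n - 1) i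
    have h3 := Ring.choose_succ_succ (n - 1) i
    rw [sub_add_cancel] at h3
    have hi : ((i : ℤ) + 1) ≠ 0 := by positivity
    apply mul_left_cancel₀ hi
    push_cast
    linear_combination (n - i - 1) * h1 + (n - i - 1) * ih - n * h2

lemma bc_vandermonde (m n : ℤ) (s : ℕ) :
    ∑ p ∈ Finset.HasAntidiagonal.antidiagonal s, bc m p.1 * bc n p.2 = bc (m + n) s := by
  simp only [bc]
  rw [Ring.add_choose_eq s (Commute.all m n), Finset.mul_sum]
  refine Finset.sum_congr rfl fun p hp => ?_
  rw [← Finset.HasAntidiagonal.mem_antidiagonal.1 hp, pow_add]; ring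

lemma bc_vandermonde' (m n : ℤ) (s : ℕ) (h : m + n = s) :
    ∑ p ∈ Finset.HasAntidiagonal.antidiagonal s, bc m p.1 * bc n p.2 * (m - p.1) = if s = 0 then m else 0 := by
  have : ∀ p ∈ Finset.HasAntidiagonal.antidiagonal s, bc m p.1 * bc n p.2 * (m - p.1)
      = (-1) ^ s * m * (Ring.choose (m - 1) p.1 * Ring.choose n p.2) := by
    intro p hp
    have := choose_mul_sub m p.1
    rw [← Finset.HasAntidiagonal.mem_antidiagonal.1 hp, pow_add]
    simp only [bc]
    linear_combination (-1) ^ p.1 * (-1) ^ p.2 * Ring.choose n p.2 * this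
  rw [Finset.sum_congr rfl this, ← Finset.mul_sum, ← Ring.add_choose_eq s (Commute.all (m - 1) n)]
  rcases s with _ | s
  · simp
  · have : m - 1 + n = (s : ℤ) := by push_cast at h; linarith
    rw [this, Ring.choose_natCast]
    simp

/-- The sign `(-1)^n`, `n` an integer. -/
def sg (n : ℤ) : ℤ := (n.negOnePow : ℤ)

lemma sg_add (m n : ℤ) : sg (m + n) = sg m * sg n := by simp [sg, Int.negOnePow_add]
lemma sg_succ (n : ℤ) : sg (n + 1) = - sg n := by simp [sg, Int.negOnePow_succ]
lemma sg_nat (n : ℕ) : sg n = (-1) ^ n := by simp [sg, Int.coe_negOnePow_natCast]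
lemma sg_zero : sg 0 = 1 := by simp [sg]

section finsum
variable {M : Type*} [AddCommGroup M]

lemma finsum_eq_range (f : ℕ → M) (K : ℕ) (h : ∀ i, K ≤ i → f i = 0) :
    ∑ᶠ i, f i = ∑ i ∈ Finset.range K, f i := by
  apply finsum_eq_sum_of_support_subset
  intro i hi
  simp only [Finset.coe_range, Set.mem_Iio]
  by_contra h'
  exact hi (h i (by omega))

lemma sum_box (f : ℕ → ℕ → M) (K : ℕ) (h1 : ∀ i j, K ≤ i → f i j = 0)
    (h2 : ∀ i j, K ≤ j → f i j = 0) :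
    ∑ i ∈ Finset.range K, ∑ j ∈ Finset.range K, f i j
      = ∑ s ∈ Finset.range (2 * K), ∑ p ∈ Finset.HasAntidiagonal.antidiagonal s, f p.1 p.2 := by
  rw [← Finset.sum_product', Finset.sum_sigma']
  refine Finset.sum_bij_ne_zero (fun p _ _ => ⟨p.1 + p.2, p⟩) ?_ ?_ ?_ ?_
  · intro p hp _
    simp only [Finset.mem_product, Finset.mem_range] at hp
    simp; omega
  · intro p _ _ q _ _ h
    simpa using (Sigma.mk.inj_iff.1 h).2
  · rintro ⟨s, p⟩ hp h0
    simp only [Finset.mem_sigma, Finset.mem_range, Finset.HasAntidiagonal.mem_antidiagonal] at hp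
    refine ⟨p, ?_, h0, ?_⟩
    · simp only [Finset.mem_product, Finset.mem_range]
      constructor
      · by_contra h; exact h0 (h1 _ _ (not_lt.1 h))
      · by_contra h; exact h0 (h2 _ _ (not_lt.1 h))
    · obtain ⟨h, rfl⟩ := hp; rfl
  · intros; rfl
end finsum

section fields
variable {V : Type*} [AddCommGroup V] [Module ℂ V]

/-- The mode `A_n` of a field `A(x) = ∑ A_n x^(-n-1)`. -/
abbrev mode (A : VertexOperator ℂ V) (n : ℤ) : Module.End ℂ V := VertexOperator.ncoeff A n

lemma mode_add (A B : VertexOperator ℂ V) (n : ℤ) (w : V) :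
    mode (A + B) n w = mode A n w + mode B n w := by simp [mode]

lemma mode_smul (r : ℂ) (A : VertexOperator ℂ V) (n : ℤ) (w : V) :
    mode (r • A) n w = r • mode A n w := by simp [mode]

lemma trunc (A : VertexOperator ℂ V) (w : V) : ∃ K : ℕ, ∀ n : ℤ, K ≤ n → mode A n w = 0 := by
  refine ⟨(-(HahnSeries.order ((HahnModule.of ℂ).symm (A w)))).toNat, fun n hn => ?_⟩
  apply VertexOperator.ncoeff_eq_zero_of_lt_order
  omega

/-- The field `∑ f n x^(-n-1)` with prescribed modes `f n`. -/
def ofModes (f : ℤ → Module.End ℂ V) (hf : ∀ w, ∃ K : ℕ, ∀ n : ℤ, K ≤ n → f n w = 0) :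
    VertexOperator ℂ V :=
  VertexOperator.of_coeff (fun n => f (-n - 1)) fun w => by
    obtain ⟨K, hK⟩ := hf w
    refine ⟨-K, fun n hn => ?_⟩
    by_contra h
    exact hn (hK _ (by omega))

@[simp] lemma ofModes_ncoeff (f : ℤ → Module.End ℂ V) (hf) (n : ℤ) :
    mode (ofModes f hf) n = f n := by
  simp [ofModes]

lemma field_ext {A B : VertexOperator ℂ V} (h : ∀ n w, mode A n w = mode B n w) : A = B := by
  apply HVertexOperator.coeff_inj
  funext n
  rw [VertexOperator.coeff_eq_ncoeff, VertexOperator.coeff_eq_ncoeff]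
  exact LinearMap.ext (h _)

/-- The `i`-th summand of the `k`-th mode of the residue product `A(x)_n B(x)`. -/
def resTerm (n k : ℤ) (A B : VertexOperator ℂ V) (w : V) (i : ℕ) : V :=
  bc n i • (mode A (n - i) (mode B (k + i) w) - sg n • mode B (n + k - i) (mode A i w))

lemma resTerm_eq_zero (n k : ℤ) (A B : VertexOperator ℂ V) (w : V) :
    ∃ K : ℕ, ∀ i, K ≤ i → resTerm n k A B w i = 0 := by
  obtain ⟨K, hK⟩ := trunc A w
  obtain ⟨L, hL⟩ := trunc B w
  refine ⟨K + (L - k).toNat, fun i hi => ?_⟩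
  rw [resTerm, hK i (by omega), hL (k + i) (by omega)]
  simp

lemma resTerm_finite (n k : ℤ) (A B : VertexOperator ℂ V) (w : V) :
    (Function.support (resTerm n k A B w)).Finite := by
  obtain ⟨K, hK⟩ := resTerm_eq_zero n k A B w
  refine (Set.finite_lt_nat K).subset fun i hi => ?_
  by_contra h
  exact hi (hK i (not_lt.1 h))

/-- The `n`-th residue product
`A(x)_n B(x) = Res_t ((t - x)^n A(t) B(x) - (-x + t)^n B(x) A(t))` of two fields. -/
def resProd (n : ℤ) (A B : VertexOperator ℂ V) : VertexOperator ℂ V :=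
  ofModes (fun k =>
    { toFun := fun w => ∑ᶠ i : ℕ, resTerm n k A B w i
      map_add' := fun v w => by
        refine Eq.trans (finsum_congr fun i => ?_) (finsum_add_distrib
          (resTerm_finite n k A B v) (resTerm_finite n k A B w))
        simp only [resTerm, map_add, smul_add, smul_sub]; abel
      map_smul' := fun r w => by
        rw [RingHom.id_apply, smul_finsum' r (resTerm_finite n k A B w)]
        refine finsum_congr fun i => ?_
        simp only [resTerm, map_smul, smul_sub, smul_comm r] }) <| fun w => by
    obtain ⟨L, hL⟩ := trunc B w
    obtain ⟨K, hK⟩ := trunc A w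
    have : ∃ M : ℕ, ∀ i < K, ∀ l : ℤ, M ≤ l → mode B l (mode A i w) = 0 := by
      choose g hg using fun i : ℕ => trunc B (mode A i w)
      exact ⟨∑ i ∈ Finset.range K, g i, fun i hi l hl => hg i l (le_trans (by
        exact_mod_cast Finset.single_le_sum (f := g) (fun _ _ => Nat.zero_le _)
          (Finset.mem_range.2 hi)) hl)⟩
    obtain ⟨M, hM⟩ := this
    refine ⟨L + M + K + (-n).toNat, fun k hk => ?_⟩
    change ∑ᶠ i : ℕ, _ = (0 : V)
    rw [← finsum_zero (α := ℕ)]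
    refine finsum_congr fun i => ?_
    rw [resTerm, hL _ (by omega)]
    by_cases hi : i < K
    · rw [hM i hi _ (by omega)]; simp
    · rw [hK i (by omega)]; simp

lemma resProd_apply (n k : ℤ) (A B : VertexOperator ℂ V) (w : V) :
    mode (resProd n A B) k w = ∑ᶠ i : ℕ, resTerm n k A B w i := by
  simp [resProd]

lemma resProd_apply_range (n k : ℤ) (A B : VertexOperator ℂ V) (w : V) (K : ℕ)
    (h1 : ∀ i : ℕ, K ≤ i → mode A i w = 0) (h2 : ∀ i : ℕ, K ≤ i → mode B (k + i) w = 0) :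
    mode (resProd n A B) k w = ∑ i ∈ Finset.range K, resTerm n k A B w i := by
  rw [resProd_apply, finsum_eq_range _ K]
  intro i hi
  rw [resTerm, h1 i hi, h2 i hi]; simp

lemma resProd_add_right (n : ℤ) (A B C : VertexOperator ℂ V) :
    resProd n A (B + C) = resProd n A B + resProd n A C := by
  refine field_ext fun k w => ?_
  rw [mode_add]
  simp only [resProd_apply]
  rw [← finsum_add_distrib (resTerm_finite n k A B w) (resTerm_finite n k A C w)]
  refine finsum_congr fun i => ?_
  simp only [resTerm, map_add, mode_add, smul_add, smul_sub]; abel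

lemma resProd_add_left (n : ℤ) (A B C : VertexOperator ℂ V) :
    resProd n (A + B) C = resProd n A C + resProd n B C := by
  refine field_ext fun k w => ?_
  rw [mode_add]
  simp only [resProd_apply]
  rw [← finsum_add_distrib (resTerm_finite n k A C w) (resTerm_finite n k B C w)]
  refine finsum_congr fun i => ?_
  simp only [resTerm, map_add, mode_add, smul_add, smul_sub]; abel

lemma resProd_smul_right (n : ℤ) (r : ℂ) (A B : VertexOperator ℂ V) :
    resProd n A (r • B) = r • resProd n A B := by
  refine field_ext fun k w => ?_
  rw [mode_smul]
  simp only [resProd_apply]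
  rw [smul_finsum' r (resTerm_finite n k A B w)]
  refine finsum_congr fun i => ?_
  simp only [resTerm, map_smul, mode_smul, smul_sub, smul_comm r]

lemma resProd_smul_left (n : ℤ) (r : ℂ) (A B : VertexOperator ℂ V) :
    resProd n (r • A) B = r • resProd n A B := by
  refine field_ext fun k w => ?_
  rw [mode_smul]
  simp only [resProd_apply]
  rw [smul_finsum' r (resTerm_finite n k A B w)]
  refine finsum_congr fun i => ?_
  simp only [resTerm, map_smul, mode_smul, smul_sub, smul_comm r]

/-- The residue product as a bilinear map. -/
def resProdₗ (n : ℤ) : VertexOperator ℂ V →ₗ[ℂ] VertexOperator ℂ V →ₗ[ℂ] VertexOperator ℂ V :=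
  LinearMap.mk₂ ℂ (resProd n) (resProd_add_left n) (fun r A B => resProd_smul_left n r A B)
    (resProd_add_right n) (fun r A B => resProd_smul_right n r A B)

@[simp] lemma resProdₗ_apply (n : ℤ) (A B : VertexOperator ℂ V) :
    resProdₗ n A B = resProd n A B := rfl

end fields
end VA
end

noncomputable section
namespace VA
section comm
variable {V : Type*} [AddCommGroup V] [Module ℂ V]

lemma trunc_two (A B : VertexOperator ℂ V) (w : V) :
    ∃ K : ℕ, ∀ i : ℕ, ∀ n : ℤ, K ≤ n → mode B n (mode A i w) = 0 := by
  obtain ⟨K, hK⟩ := trunc A w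
  choose g hg using fun i : ℕ => trunc B (mode A i w)
  refine ⟨∑ i ∈ Finset.range K, g i, fun i n hn => ?_⟩
  by_cases hi : i < K
  · exact hg i n (le_trans (by
      exact_mod_cast Finset.single_le_sum (f := g) (fun _ _ => Nat.zero_le _)
        (Finset.mem_range.2 hi)) hn)
  · rw [hK i (by omega)]; simp

/-- The four terms of the `k`-th mode of `A(x)_m (B(x)_n D(x))` applied to `w`. -/
def quadTerm (m n k : ℤ) (A B D : VertexOperator ℂ V) (w : V) (i j : ℕ) : V :=
  (bc m i * bc n j) • (mode A (m - i) (mode B (n - j) (mode D (k + i + j) w))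
    - sg n • mode A (m - i) (mode D (n + k + i - j) (mode B j w))
    - sg m • mode B (n - j) (mode D (m + k - i + j) (mode A i w))
    + sg (m + n) • mode D (m + n + k - i - j) (mode B j (mode A i w)))

lemma resProd_resProd (m n k : ℤ) (A B D : VertexOperator ℂ V) (w : V) :
    ∃ K₀ : ℕ, ∀ K, K₀ ≤ K → mode (resProd m A (resProd n B D)) k w =
      ∑ i ∈ Finset.range K, ∑ j ∈ Finset.range K, quadTerm m n k A B D w i j := by
  obtain ⟨a, ha⟩ := trunc A w
  obtain ⟨b, hb⟩ := trunc B w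
  obtain ⟨d, hd⟩ := trunc D w
  obtain ⟨ab, hab⟩ := trunc_two A B w
  obtain ⟨ad, had⟩ := trunc_two A D w
  obtain ⟨bd, hbd⟩ := trunc_two B D w
  obtain ⟨r, hr⟩ := trunc (resProd n B D) w
  refine ⟨a + b + d + ab + ad + bd + r + k.natAbs + m.natAbs + n.natAbs, fun K hK => ?_⟩
  rw [resProd_apply_range m k A (resProd n B D) w K (fun i hi => ha _ (by omega))
    (fun i hi => hr _ (by omega))]
  refine Finset.sum_congr rfl fun i hi => ?_
  rw [Finset.mem_range] at hi
  have h2 : mode (resProd n B D) (m + k - i) (mode A i w) =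
      ∑ j ∈ Finset.range K, resTerm n (m + k - i) B D (mode A i w) j := by
    by_cases hia : a ≤ i
    · rw [ha i (by omega), map_zero]
      exact (Finset.sum_eq_zero fun j _ => by simp [resTerm]).symm
    · exact resProd_apply_range n (m + k - i) B D (mode A i w) K
        (fun j hj => hab _ _ (by omega)) (fun j hj => had _ _ (by omega))
  rw [resTerm, h2, resProd_apply_range n (k + i) B D w K (fun j hj => hb _ (by omega))
    (fun j hj => hd _ (by omega)), map_sum, Finset.smul_sum, ← Finset.sum_sub_distrib,
    Finset.smul_sum]
  refine Finset.sum_congr rfl fun j _ => ?_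
  have e1 : n + (k + i) - j = n + k + i - (j : ℤ) := by ring
  have e2 : n + (m + k - i) - j = m + n + k - i - (j : ℤ) := by ring
  simp only [quadTerm, resTerm, map_zsmul, map_sub, e1, e2, sg_add]
  module

/-- If the modes of `A`, `B`, `C` satisfy `[A_i, B_j] = C_(i+j) + i δ_(i+j,0) s`, then so do the
operators of left residue multiplication by `A`, `B`, `C` on the space of all fields. -/
theorem resProd_commutator (A B C D : VertexOperator ℂ V) (s : ℂ)
    (h : ∀ i j w, mode A i (mode B j w) - mode B j (mode A i w) =
      mode C (i + j) w + if i + j = 0 then ((i : ℂ) * s) • w else 0) (m n : ℤ) :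
    resProd m A (resProd n B D) - resProd n B (resProd m A D) =
      resProd (m + n) C D + if m + n = 0 then ((m : ℂ) * s) • D else 0 := by
  refine field_ext fun k w => ?_
  obtain ⟨K1, h1⟩ := resProd_resProd m n k A B D w
  obtain ⟨K2, h2⟩ := resProd_resProd n m k B A D w
  obtain ⟨a, ha⟩ := trunc A w
  obtain ⟨b, hb⟩ := trunc B w
  obtain ⟨c, hc⟩ := trunc C w
  obtain ⟨d, hd⟩ := trunc D w
  obtain ⟨ab, hab⟩ := trunc_two A B w
  obtain ⟨ba, hba⟩ := trunc_two B A w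
  set K := K1 + K2 + a + b + c + d + ab + ba + k.natAbs + 1 with hK
  have e1 : mode (resProd m A (resProd n B D) - resProd n B (resProd m A D)) k w =
      ∑ i ∈ Finset.range K, ∑ j ∈ Finset.range K, (bc m i * bc n j) •
        (mode A (m - i) (mode B (n - j) (mode D (k + i + j) w))
          - mode B (n - j) (mode A (m - i) (mode D (k + i + j) w))
          - sg (m + n) • mode D (m + n + k - i - j)
            (mode A i (mode B j w) - mode B j (mode A i w))) := by
    have : mode (resProd m A (resProd n B D) - resProd n B (resProd m A D)) k w =
      mode (resProd m A (resProd n B D)) k w - mode (resProd n B (resProd m A D)) k w := by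
      simp [mode]
    rw [this, h1 K (by omega), h2 K (by omega), Finset.sum_comm (s := Finset.range K)
      (f := fun i j => quadTerm n m k B A D w i j), ← Finset.sum_sub_distrib]
    refine Finset.sum_congr rfl fun i _ => ?_
    rw [← Finset.sum_sub_distrib]
    refine Finset.sum_congr rfl fun j _ => ?_
    have e1 : m + k + j - i = m + k - i + (j : ℤ) := by ring
    have e2 : n + k - j + i = n + k + i - (j : ℤ) := by ring
    have e3 : n + m + k - j - i = m + n + k - i - (j : ℤ) := by ring
    have e4 : k + j + i = k + i + (j : ℤ) := by ring
    simp only [quadTerm, map_sub, e1, e2, e3, e4, sg_add]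
    module
  rw [e1, sum_box]
  rotate_left
  · intro i j hi
    rw [hd (k + i + j) (by omega), ha i (by omega), hba _ _ (by omega)]; simp
  · intro i j hj
    rw [hd (k + i + j) (by omega), hb j (by omega), hab _ _ (by omega)]; simp
  rw [mode_add, resProd_apply_range (m + n) k C D w (2 * K) (fun i hi => hc _ (by omega))
    (fun i hi => hd _ (by omega))]
  have e2 : mode (if m + n = 0 then ((m : ℂ) * s) • D else 0) k w = ∑ t ∈ Finset.range (2 * K),
      if t = 0 ∧ m + n = 0 then ((m : ℂ) * s) • mode D k w else 0 := by
    rw [Finset.sum_eq_single_of_mem 0 (by simp; omega) (by intro t _ ht; simp [ht])]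
    split_ifs <;> simp_all [mode]
  rw [e2, ← Finset.sum_add_distrib]
  refine Finset.sum_congr rfl fun t _ => ?_
  have e3 : ∀ p ∈ Finset.HasAntidiagonal.antidiagonal t, (bc m p.1 * bc n p.2) •
        (mode A (m - p.1) (mode B (n - p.2) (mode D (k + p.1 + p.2) w))
          - mode B (n - p.2) (mode A (m - p.1) (mode D (k + p.1 + p.2) w))
          - sg (m + n) • mode D (m + n + k - p.1 - p.2)
            (mode A p.1 (mode B p.2 w) - mode B p.2 (mode A p.1 w))) =
      (bc m p.1 * bc n p.2) • (mode C (m + n - t) (mode D (k + t) w)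
          - sg (m + n) • mode D (m + n + k - t) (mode C t w)) +
      (bc m p.1 * bc n p.2 * (m - p.1)) • (if m + n = t then s • mode D (k + t) w else 0) := by
    intro p hp
    have hp := Finset.HasAntidiagonal.mem_antidiagonal.1 hp
    have hp' : (p.1 : ℤ) + p.2 = t := by exact_mod_cast hp
    rw [h, h]
    have f1 : m - p.1 + (n - p.2) = m + n - t := by rw [← hp']; ring
    have f2 : m + n + k - p.1 - p.2 = m + n + k - t := by rw [← hp']; ring
    have f3 : k + p.1 + p.2 = k + t := by rw [← hp']; ring
    have f4 : (if (p.1 : ℤ) + p.2 = 0 then (((p.1 : ℤ) : ℂ) * s) • w else 0) = 0 := by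
      split_ifs with h0
      · have : p.1 = 0 := by omega
        simp [this]
      · rfl
    rw [f1, f2, f3, f4, hp', add_zero]
    simp only [sub_eq_zero]
    split_ifs
    · rw [← Int.cast_smul_eq_zsmul ℂ (bc m p.1 * bc n p.2 * (m - p.1))]
      push_cast
      module
    · simp
  rw [Finset.sum_congr rfl e3, Finset.sum_add_distrib, ← Finset.sum_smul, ← Finset.sum_smul,
    bc_vandermonde, resTerm]
  congr 1
  by_cases hmn : m + n = t
  · rw [if_pos hmn, bc_vandermonde' m n t hmn]
    rcases Nat.eq_zero_or_pos t with rfl | ht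
    · rw [if_pos rfl, if_pos ⟨rfl, by simpa using hmn⟩, ← Int.cast_smul_eq_zsmul ℂ]
      simp [smul_smul]
    · rw [if_neg (by omega), if_neg (by omega)]; simp
  · rw [if_neg hmn, if_neg (by rintro ⟨rfl, h0⟩; exact hmn (by simpa using h0))]; simp
end comm
end VA
end

noncomputable section
namespace VA
section dong
variable {V : Type*} [AddCommGroup V] [Module ℂ V]

/-- Multiplication of `∑ G m n x^(-m-1) y^(-n-1)` by `x - y`, on coefficients. -/
def mulSub {M : Type*} [AddCommGroup M] (G : ℤ → ℤ → M) : ℤ → ℤ → M :=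
  fun m n => G (m + 1) n - G m (n + 1)

/-- Mutual locality of two fields: `(x - y)^K [A(x), B(y)] = 0` for some `K`. -/
def Local (A B : VertexOperator ℂ V) : Prop :=
  ∃ K : ℕ, ∀ w, mulSub^[K] (fun m n => mode A m (mode B n w) - mode B n (mode A m w)) = 0

lemma mulSub_map {M M' : Type*} [AddCommGroup M] [AddCommGroup M'] (f : M →+ M') (K : ℕ)
    (G : ℤ → ℤ → M) :
    mulSub^[K] (fun m n => f (G m n)) = fun m n => f (mulSub^[K] G m n) := by
  induction K with
  | zero => rfl
  | succ K ih =>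
    rw [Function.iterate_succ_apply', Function.iterate_succ_apply', ih]
    funext m n
    simp [mulSub]

lemma mulSub_zero {M : Type*} [AddCommGroup M] (K : ℕ) :
    mulSub^[K] (0 : ℤ → ℤ → M) = 0 := by
  induction K with
  | zero => rfl
  | succ K ih =>
    rw [Function.iterate_succ_apply', ih]; funext m n; simp [mulSub]

lemma mulSub_add {M : Type*} [AddCommGroup M] (K : ℕ) (G H : ℤ → ℤ → M) :
    mulSub^[K] (G + H) = mulSub^[K] G + mulSub^[K] H := by
  induction K with
  | zero => rfl
  | succ K ih =>
    rw [Function.iterate_succ_apply', Function.iterate_succ_apply', Function.iterate_succ_apply',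
      ih]
    funext m n; simp only [mulSub, Pi.add_apply]; abel

lemma mulSub_swap {M : Type*} [AddCommGroup M] (K : ℕ) (G : ℤ → ℤ → M) (m n : ℤ) :
    mulSub^[K] (fun m n => G n m) m n = (-1 : ℤ) ^ K • mulSub^[K] G n m := by
  induction K generalizing m n with
  | zero => simp
  | succ K ih =>
    rw [Function.iterate_succ_apply', Function.iterate_succ_apply']
    simp only [mulSub, ih, pow_succ]
    module

lemma mulSub_le {M : Type*} [AddCommGroup M] {K L : ℕ} (h : K ≤ L) {G : ℤ → ℤ → M}
    (h0 : mulSub^[K] G = 0) : mulSub^[L] G = 0 := by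
  obtain ⟨d, rfl⟩ := Nat.exists_eq_add_of_le h
  rw [add_comm, Function.iterate_add_apply, h0, mulSub_zero]

lemma Local.symm {A B : VertexOperator ℂ V} (h : Local A B) : Local B A := by
  obtain ⟨K, hK⟩ := h
  refine ⟨K, fun w => ?_⟩
  funext m n
  have h1 := mulSub_swap K (fun m n => mode B n (mode A m w) - mode A m (mode B n w)) m n
  have h2 := congrFun (congrFun (mulSub_map (-AddMonoidHom.id V) K
    (fun m n => mode A m (mode B n w) - mode B n (mode A m w))) n) m
  simp only [AddMonoidHom.neg_apply, AddMonoidHom.id_apply, neg_sub, hK] at h2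
  rw [h1, h2]; simp

lemma Local.add {A B C : VertexOperator ℂ V} (h : Local A C) (h' : Local B C) :
    Local (A + B) C := by
  obtain ⟨K, hK⟩ := h
  obtain ⟨L, hL⟩ := h'
  refine ⟨K + L, fun w => ?_⟩
  have h1 := mulSub_le (Nat.le_add_right K L) (hK w)
  have h2 := mulSub_le (Nat.le_add_left L K) (hL w)
  have := mulSub_add (K + L) (fun m n => mode A m (mode C n w) - mode C n (mode A m w))
    (fun m n => mode B m (mode C n w) - mode C n (mode B m w))
  rw [h1, h2, add_zero] at this
  rw [← this]
  congr 1
  funext m n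
  simp only [mode_add, Pi.add_apply, map_add]; abel

lemma Local.smul {A C : VertexOperator ℂ V} (r : ℂ) (h : Local A C) : Local (r • A) C := by
  obtain ⟨K, hK⟩ := h
  refine ⟨K, fun w => ?_⟩
  have := mulSub_map (DistribSMul.toAddMonoidHom V r) K
    (fun m n => mode A m (mode C n w) - mode C n (mode A m w))
  rw [hK w] at this
  simp only [DistribSMul.toAddMonoidHom_apply, Pi.zero_apply, smul_zero, smul_sub] at this
  rw [show (0 : ℤ → ℤ → V) = fun _ _ => 0 from rfl, ← this]
  congr 1
  funext m n
  simp only [mode_smul, map_smul]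

lemma Local.of_commute {A C : VertexOperator ℂ V}
    (h : ∀ m n w, mode A m (mode C n w) = mode C n (mode A m w)) : Local A C :=
  ⟨0, fun w => by funext m n; simp [h]⟩

/-- Families indexed by the exponents of three formal variables `t`, `x`, `y`. -/
abbrev F3 (V : Type*) := ℤ → ℤ → ℤ → V

def shT : Module.End ℂ (F3 V) :=
  { toFun := fun G p k l => G (p + 1) k l, map_add' := fun _ _ => rfl, map_smul' := fun _ _ => rfl }
def shX : Module.End ℂ (F3 V) :=
  { toFun := fun G p k l => G p (k + 1) l, map_add' := fun _ _ => rfl, map_smul' := fun _ _ => rfl }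
def shY : Module.End ℂ (F3 V) :=
  { toFun := fun G p k l => G p k (l + 1), map_add' := fun _ _ => rfl, map_smul' := fun _ _ => rfl }

/-- Multiplication by `t - x`, `t - y`, `x - y`. -/
def opS : Module.End ℂ (F3 V) := shT - shX
def opQ : Module.End ℂ (F3 V) := shT - shY
def opR : Module.End ℂ (F3 V) := shX - shY

lemma opS_apply (G : F3 V) (p k l : ℤ) : opS G p k l = G (p + 1) k l - G p (k + 1) l := rfl
lemma opQ_apply (G : F3 V) (p k l : ℤ) : opQ G p k l = G (p + 1) k l - G p k (l + 1) := rfl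
lemma opR_apply (G : F3 V) (p k l : ℤ) : opR G p k l = G p (k + 1) l - G p k (l + 1) := rfl

lemma comm_SQ : Commute (opS : Module.End ℂ (F3 V)) opQ := by
  refine LinearMap.ext fun G => ?_; funext p k l; simp only [Module.End.mul_apply, opS_apply, opQ_apply]; abel
lemma comm_RQ : Commute (opR : Module.End ℂ (F3 V)) opQ := by
  refine LinearMap.ext fun G => ?_; funext p k l; simp only [Module.End.mul_apply, opR_apply, opQ_apply]; abel
lemma comm_RS : Commute (opR : Module.End ℂ (F3 V)) opS := by
  refine LinearMap.ext fun G => ?_; funext p k l; simp only [Module.End.mul_apply, opR_apply, opS_apply]; abel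
lemma opR_eq : (opR : Module.End ℂ (F3 V)) = opQ - opS := by simp [opR, opQ, opS]

lemma opS_pow (N : ℕ) (G : F3 V) (p k l : ℤ) :
    (opS ^ N) G p k l = mulSub^[N] (fun p k => G p k l) p k := by
  induction N generalizing p k with
  | zero => rfl
  | succ N ih => rw [pow_succ', Module.End.mul_apply, opS_apply, ih, ih,
      Function.iterate_succ_apply', mulSub]
lemma opQ_pow (N : ℕ) (G : F3 V) (p k l : ℤ) :
    (opQ ^ N) G p k l = mulSub^[N] (fun p l => G p k l) p l := by
  induction N generalizing p l with
  | zero => rfl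
  | succ N ih => rw [pow_succ', Module.End.mul_apply, opQ_apply, ih, ih,
      Function.iterate_succ_apply', mulSub]
lemma opR_pow (N : ℕ) (G : F3 V) (p k l : ℤ) :
    (opR ^ N) G p k l = mulSub^[N] (fun k l => G p k l) k l := by
  induction N generalizing k l with
  | zero => rfl
  | succ N ih => rw [pow_succ', Module.End.mul_apply, opR_apply, ih, ih,
      Function.iterate_succ_apply', mulSub]

lemma sub_pow_kill {M : Type*} [AddCommGroup M] [Module ℂ M] (S Q : Module.End ℂ M)
    (hc : Commute S Q) (a b : ℕ) (h : M) (ha : (S ^ a) h = 0) (hb : (Q ^ b) h = 0) :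
    ((Q - S) ^ (a + b)) h = 0 := by
  induction hn : a + b generalizing a b h with
  | zero =>
    have : a = 0 := by omega
    subst this
    simpa using ha
  | succ n ih =>
    rw [pow_succ, Module.End.mul_apply, LinearMap.sub_apply, map_sub]
    rcases Nat.eq_zero_or_pos a with rfl | hapos
    · have : h = 0 := by simpa using ha
      simp [this]
    rcases Nat.eq_zero_or_pos b with rfl | hbpos
    · have : h = 0 := by simpa using hb
      simp [this]
    rw [ih a (b - 1) (Q h) ?_ ?_ (by omega), ih (a - 1) b (S h) ?_ ?_ (by omega), sub_zero]
    · rw [← Module.End.mul_apply, ← pow_succ, Nat.sub_add_cancel hapos, ha]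
    · rw [← Module.End.mul_apply, ← (hc.pow_right b).eq, Module.End.mul_apply, hb, map_zero]
    · rw [← Module.End.mul_apply, (hc.pow_left a).eq, Module.End.mul_apply, ha, map_zero]
    · rw [← Module.End.mul_apply, ← pow_succ, Nat.sub_add_cancel hbpos, hb]

/-- Families that can be multiplied by `(t - x)^n` expanded in powers of `x`, resp. of `t`. -/
def finL : Submodule ℂ (F3 V) where
  carrier := {G | ∀ p k l : ℤ, ∃ K : ℕ, ∀ i : ℕ, K ≤ i → G (p - i) (k + i) l = 0}
  zero_mem' := fun _ _ _ => ⟨0, fun _ _ => rfl⟩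
  add_mem' := fun {G H} hG hH p k l => by
    obtain ⟨K, hK⟩ := hG p k l
    obtain ⟨L, hL⟩ := hH p k l
    exact ⟨K + L, fun i hi => by simp [hK i (by omega), hL i (by omega)]⟩
  smul_mem' := fun r G hG p k l => by
    obtain ⟨K, hK⟩ := hG p k l
    exact ⟨K, fun i hi => by simp [hK i hi]⟩

def finR : Submodule ℂ (F3 V) where
  carrier := {G | ∀ p k l : ℤ, ∃ K : ℕ, ∀ i : ℕ, K ≤ i → G (p + i) (k - i) l = 0}
  zero_mem' := fun _ _ _ => ⟨0, fun _ _ => rfl⟩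
  add_mem' := fun {G H} hG hH p k l => by
    obtain ⟨K, hK⟩ := hG p k l
    obtain ⟨L, hL⟩ := hH p k l
    exact ⟨K + L, fun i hi => by simp [hK i (by omega), hL i (by omega)]⟩
  smul_mem' := fun r G hG p k l => by
    obtain ⟨K, hK⟩ := hG p k l
    exact ⟨K, fun i hi => by simp [hK i hi]⟩

/-- Multiplication by `(t - x)^n`, expanded in powers of `x`, resp. of `t`. -/
def expL (n : ℤ) (G : F3 V) : F3 V := fun p k l => ∑ᶠ i : ℕ, bc n i • G (p + n - i) (k + i) l
def expR (n : ℤ) (G : F3 V) : F3 V :=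
  fun p k l => ∑ᶠ i : ℕ, (bc n i * sg n) • G (p + i) (k + n - i) l

lemma finL_shift {G : F3 V} (hG : G ∈ finL) (a b c : ℤ) :
    (fun p k l => G (p + a) (k + b) (l + c)) ∈ finL := fun p k l => by
  obtain ⟨K, hK⟩ := hG (p + a) (k + b) (l + c)
  refine ⟨K, fun i hi => ?_⟩
  have := hK i hi
  rwa [show p + a - (i : ℤ) = p - i + a by ring, show k + b + (i : ℤ) = k + i + b by ring] at this

lemma finR_shift {G : F3 V} (hG : G ∈ finR) (a b c : ℤ) :
    (fun p k l => G (p + a) (k + b) (l + c)) ∈ finR := fun p k l => by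
  obtain ⟨K, hK⟩ := hG (p + a) (k + b) (l + c)
  refine ⟨K, fun i hi => ?_⟩
  have := hK i hi
  rwa [show p + a + (i : ℤ) = p + i + a by ring, show k + b - (i : ℤ) = k - i + b by ring] at this

lemma expL_range {G : F3 V} (hG : G ∈ finL) (n p k l : ℤ) : ∃ K : ℕ, ∀ L, K ≤ L →
    expL n G p k l = ∑ i ∈ Finset.range L, bc n i • G (p + n - i) (k + i) l := by
  obtain ⟨K, hK⟩ := hG (p + n) k l
  exact ⟨K, fun L hL => finsum_eq_range _ L fun i hi => by rw [hK i (by omega), smul_zero]⟩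

lemma expR_range {G : F3 V} (hG : G ∈ finR) (n p k l : ℤ) : ∃ K : ℕ, ∀ L, K ≤ L →
    expR n G p k l = ∑ i ∈ Finset.range L, (bc n i * sg n) • G (p + i) (k + n - i) l := by
  obtain ⟨K, hK⟩ := hG p (k + n) l
  exact ⟨K, fun L hL => finsum_eq_range _ L fun i hi => by rw [hK i (by omega), smul_zero]⟩

lemma expL_sub {G H : F3 V} (hG : G ∈ finL) (hH : H ∈ finL) (n : ℤ) :
    expL n (G - H) = expL n G - expL n H := by
  funext p k l
  obtain ⟨K, hK⟩ := expL_range hG n p k l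
  obtain ⟨L, hL⟩ := expL_range hH n p k l
  obtain ⟨M, hM⟩ := expL_range (sub_mem hG hH) n p k l
  simp only [Pi.sub_apply]
  rw [hK (K + L + M) (by omega), hL (K + L + M) (by omega), hM (K + L + M) (by omega),
    ← Finset.sum_sub_distrib]
  exact Finset.sum_congr rfl fun i _ => by simp only [Pi.sub_apply, smul_sub]

lemma expR_sub {G H : F3 V} (hG : G ∈ finR) (hH : H ∈ finR) (n : ℤ) :
    expR n (G - H) = expR n G - expR n H := by
  funext p k l
  obtain ⟨K, hK⟩ := expR_range hG n p k l
  obtain ⟨L, hL⟩ := expR_range hH n p k l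
  obtain ⟨M, hM⟩ := expR_range (sub_mem hG hH) n p k l
  simp only [Pi.sub_apply]
  rw [hK (K + L + M) (by omega), hL (K + L + M) (by omega), hM (K + L + M) (by omega),
    ← Finset.sum_sub_distrib]
  exact Finset.sum_congr rfl fun i _ => by simp only [Pi.sub_apply, smul_sub]

lemma shT_finL {G : F3 V} (hG : G ∈ finL) : shT G ∈ finL := by
  simpa [shT] using! finL_shift hG 1 0 0
lemma shX_finL {G : F3 V} (hG : G ∈ finL) : shX G ∈ finL := by
  simpa [shX] using! finL_shift hG 0 1 0
lemma shY_finL {G : F3 V} (hG : G ∈ finL) : shY G ∈ finL := by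
  simpa [shY] using! finL_shift hG 0 0 1
lemma shT_finR {G : F3 V} (hG : G ∈ finR) : shT G ∈ finR := by
  simpa [shT] using! finR_shift hG 1 0 0
lemma shX_finR {G : F3 V} (hG : G ∈ finR) : shX G ∈ finR := by
  simpa [shX] using! finR_shift hG 0 1 0
lemma shY_finR {G : F3 V} (hG : G ∈ finR) : shY G ∈ finR := by
  simpa [shY] using! finR_shift hG 0 0 1

lemma expL_shT (n : ℤ) (G : F3 V) : expL n (shT G) = shT (expL n G) := by
  funext p k l
  refine finsum_congr fun i => ?_
  change _ • G _ _ _ = _ • G _ _ _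
  rw [show p + n - (i : ℤ) + 1 = p + 1 + n - i by ring]
lemma expL_shX (n : ℤ) (G : F3 V) : expL n (shX G) = shX (expL n G) := by
  funext p k l
  refine finsum_congr fun i => ?_
  change _ • G _ _ _ = _ • G _ _ _
  rw [show k + (i : ℤ) + 1 = k + 1 + i by ring]
lemma expL_shY (n : ℤ) (G : F3 V) : expL n (shY G) = shY (expL n G) := rfl
lemma expR_shT (n : ℤ) (G : F3 V) : expR n (shT G) = shT (expR n G) := by
  funext p k l
  refine finsum_congr fun i => ?_
  change _ • G _ _ _ = _ • G _ _ _
  rw [show p + (i : ℤ) + 1 = p + 1 + i by ring]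
lemma expR_shX (n : ℤ) (G : F3 V) : expR n (shX G) = shX (expR n G) := by
  funext p k l
  refine finsum_congr fun i => ?_
  change _ • G _ _ _ = _ • G _ _ _
  rw [show k + n - (i : ℤ) + 1 = k + 1 + n - i by ring]
lemma expR_shY (n : ℤ) (G : F3 V) : expR n (shY G) = shY (expR n G) := rfl

lemma pow_expL (D : Module.End ℂ (F3 V)) (hD : ∀ G ∈ finL, D G ∈ finL) (n : ℤ)
    (h : ∀ G ∈ finL, expL n (D G) = D (expL n G)) (N : ℕ) (G : F3 V) (hG : G ∈ finL) :
    (D ^ N) G ∈ finL ∧ expL n ((D ^ N) G) = (D ^ N) (expL n G) := by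
  induction N with
  | zero => exact ⟨hG, rfl⟩
  | succ N ih =>
    rw [pow_succ', Module.End.mul_apply, Module.End.mul_apply]
    exact ⟨hD _ ih.1, by rw [h _ ih.1, ih.2]⟩

lemma pow_expR (D : Module.End ℂ (F3 V)) (hD : ∀ G ∈ finR, D G ∈ finR) (n : ℤ)
    (h : ∀ G ∈ finR, expR n (D G) = D (expR n G)) (N : ℕ) (G : F3 V) (hG : G ∈ finR) :
    (D ^ N) G ∈ finR ∧ expR n ((D ^ N) G) = (D ^ N) (expR n G) := by
  induction N with
  | zero => exact ⟨hG, rfl⟩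
  | succ N ih =>
    rw [pow_succ', Module.End.mul_apply, Module.End.mul_apply]
    exact ⟨hD _ ih.1, by rw [h _ ih.1, ih.2]⟩

lemma pow_opQ_L (n : ℤ) (N : ℕ) (G : F3 V) (hG : G ∈ finL) :
    (opQ ^ N) G ∈ finL ∧ expL n ((opQ ^ N) G) = (opQ ^ N) (expL n G) :=
  pow_expL _ (fun _ h => sub_mem (shT_finL h) (shY_finL h)) n (fun _ h => by
    simp only [opQ, LinearMap.sub_apply]
    rw [expL_sub (shT_finL h) (shY_finL h), expL_shT, expL_shY]) N G hG
lemma pow_opR_L (n : ℤ) (N : ℕ) (G : F3 V) (hG : G ∈ finL) :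
    (opR ^ N) G ∈ finL ∧ expL n ((opR ^ N) G) = (opR ^ N) (expL n G) :=
  pow_expL _ (fun _ h => sub_mem (shX_finL h) (shY_finL h)) n (fun _ h => by
    simp only [opR, LinearMap.sub_apply]
    rw [expL_sub (shX_finL h) (shY_finL h), expL_shX, expL_shY]) N G hG
lemma pow_opQ_R (n : ℤ) (N : ℕ) (G : F3 V) (hG : G ∈ finR) :
    (opQ ^ N) G ∈ finR ∧ expR n ((opQ ^ N) G) = (opQ ^ N) (expR n G) :=
  pow_expR _ (fun _ h => sub_mem (shT_finR h) (shY_finR h)) n (fun _ h => by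
    simp only [opQ, LinearMap.sub_apply]
    rw [expR_sub (shT_finR h) (shY_finR h), expR_shT, expR_shY]) N G hG
lemma pow_opR_R (n : ℤ) (N : ℕ) (G : F3 V) (hG : G ∈ finR) :
    (opR ^ N) G ∈ finR ∧ expR n ((opR ^ N) G) = (opR ^ N) (expR n G) :=
  pow_expR _ (fun _ h => sub_mem (shX_finR h) (shY_finR h)) n (fun _ h => by
    simp only [opR, LinearMap.sub_apply]
    rw [expR_sub (shX_finR h) (shY_finR h), expR_shX, expR_shY]) N G hG

lemma expL_zero (G : F3 V) : expL 0 G = G := by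
  funext p k l
  rw [expL, finsum_eq_range _ 1]
  · simp [bc_zero]
  · intro i hi
    obtain ⟨j, rfl⟩ := Nat.exists_eq_add_of_le' hi
    simp [bc, Ring.choose_zero_succ]

lemma expR_zero (G : F3 V) : expR 0 G = G := by
  funext p k l
  rw [expR, finsum_eq_range _ 1]
  · simp [bc_zero, sg_zero]
  · intro i hi
    obtain ⟨j, rfl⟩ := Nat.exists_eq_add_of_le' hi
    simp [bc, Ring.choose_zero_succ]

lemma opS_expL {G : F3 V} (hG : G ∈ finL) (n : ℤ) : opS (expL n G) = expL (n + 1) G := by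
  funext p k l
  rw [opS_apply]
  obtain ⟨K, hK⟩ := expL_range hG n (p + 1) k l
  obtain ⟨L, hL⟩ := expL_range hG n p (k + 1) l
  obtain ⟨M, hM⟩ := expL_range hG (n + 1) p k l
  rw [hK (K + L + M + 1) (by omega), hL (K + L + M) (by omega), hM (K + L + M + 1) (by omega),
    Finset.sum_range_succ', Finset.sum_range_succ' _ (K + L + M), add_sub_right_comm,
    ← Finset.sum_sub_distrib]
  congr 1
  · refine Finset.sum_congr rfl fun i _ => ?_
    rw [bc_succ, sub_smul]
    push_cast
    rw [show p + 1 + n - ((i : ℤ) + 1) = p + n - i by ring,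
      show p + (n + 1) - ((i : ℤ) + 1) = p + n - i by ring, show k + 1 + (i : ℤ) = k + (i + 1) by ring]
  · simp only [bc_zero]
    rw [show p + 1 + n = p + (n + 1) by ring]

lemma opS_expR {G : F3 V} (hG : G ∈ finR) (n : ℤ) : opS (expR n G) = expR (n + 1) G := by
  funext p k l
  rw [opS_apply]
  obtain ⟨K, hK⟩ := expR_range hG n (p + 1) k l
  obtain ⟨L, hL⟩ := expR_range hG n p (k + 1) l
  obtain ⟨M, hM⟩ := expR_range hG (n + 1) p k l
  rw [hK (K + L + M) (by omega), hL (K + L + M + 1) (by omega), hM (K + L + M + 1) (by omega),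
    Finset.sum_range_succ', Finset.sum_range_succ' _ (K + L + M), ← sub_sub,
    ← Finset.sum_sub_distrib, sub_eq_add_neg]
  congr 1
  · refine Finset.sum_congr rfl fun i _ => ?_
    rw [bc_succ, sg_succ]
    push_cast
    rw [show p + 1 + (i : ℤ) = p + (i + 1) by ring,
      show k + 1 + n - ((i : ℤ) + 1) = k + n - i by ring,
      show k + (n + 1) - ((i : ℤ) + 1) = k + n - i by ring]
    module
  · simp only [bc_zero, sg_succ]
    rw [show k + 1 + n = k + (n + 1) by ring]
    module

/-- Nonnegative residue products of commuting fields vanish. -/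
lemma resProd_of_commute {A B : VertexOperator ℂ V}
    (h : ∀ m n w, mode A m (mode B n w) = mode B n (mode A m w)) (n : ℕ) :
    resProd n A B = 0 := by
  refine field_ext fun k w => ?_
  let G : F3 V := fun t x _ => mode A t (mode B x w)
  have hG : (fun t x _ => mode B x (mode A t w) : F3 V) = G := by
    funext t x _; exact (h t x w).symm
  have f1 : G ∈ finL := fun p k l => by
    obtain ⟨K, hK⟩ := trunc B w
    exact ⟨K + k.natAbs, fun i hi => by simp only [G]; rw [hK _ (by omega), map_zero]⟩
  have f2 : G ∈ finR := fun p k l => by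
    obtain ⟨K, hK⟩ := trunc A w
    exact ⟨K + p.natAbs, fun i hi => by
      rw [← hG]; change mode B _ (mode A _ w) = 0; rw [hK _ (by omega), map_zero]⟩
  have e : ∀ j : ℕ, expL j G = expR j G := fun j => by
    induction j with
    | zero => rw [Nat.cast_zero, expL_zero, expR_zero]
    | succ j ih => push_cast; rw [← opS_expL f1, ← opS_expR f2, ih]
  have e' := congrFun (congrFun (congrFun (e n) 0) k) 0
  obtain ⟨K1, e1⟩ := expL_range f1 n 0 k 0
  obtain ⟨K2, e2⟩ := expR_range f2 n 0 k 0
  obtain ⟨a, ha⟩ := trunc A w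
  obtain ⟨b, hb⟩ := trunc B w
  set K := K1 + K2 + a + b + k.natAbs with hK
  rw [e1 K (by omega), e2 K (by omega), ← sub_eq_zero, ← Finset.sum_sub_distrib] at e'
  rw [resProd_apply_range n k A B w K (fun i hi => ha _ (by omega)) (fun i hi => hb _ (by omega)),
    show mode (0 : VertexOperator ℂ V) k w = 0 by simp [mode], ← e']
  refine Finset.sum_congr rfl fun i _ => ?_
  simp only [resTerm, G, ← h, zero_add, add_comm k n]
  module

/-- Dong's lemma: residue products of pairwise local fields are local. -/
theorem Local.resProd {A B C : VertexOperator ℂ V} (hAB : Local A B) (hAC : Local A C)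
    (hBC : Local B C) (n : ℤ) : Local (resProd n A B) C := by
  obtain ⟨N1, h1⟩ := hAB
  obtain ⟨N2, h2⟩ := hAC
  obtain ⟨N3, h3⟩ := hBC
  refine ⟨(N1 + n.natAbs) + N2 + N3, fun w => ?_⟩
  let G1 : F3 V := fun t x y => mode A t (mode B x (mode C y w))
  let G2 : F3 V := fun t x y => mode C y (mode A t (mode B x w))
  let G3 : F3 V := fun t x y => mode B x (mode A t (mode C y w))
  let G4 : F3 V := fun t x y => mode C y (mode B x (mode A t w))
  have f1 : G1 ∈ finL := fun p k l => by
    obtain ⟨K, hK⟩ := trunc B (mode C l w)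
    exact ⟨K + k.natAbs, fun i hi => by simp only [G1]; rw [hK _ (by omega), map_zero]⟩
  have f2 : G2 ∈ finL := fun p k l => by
    obtain ⟨K, hK⟩ := trunc B w
    exact ⟨K + k.natAbs, fun i hi => by simp only [G2]; rw [hK _ (by omega), map_zero, map_zero]⟩
  have f3 : G3 ∈ finR := fun p k l => by
    obtain ⟨K, hK⟩ := trunc A (mode C l w)
    exact ⟨K + p.natAbs, fun i hi => by simp only [G3]; rw [hK _ (by omega), map_zero]⟩
  have f4 : G4 ∈ finR := fun p k l => by
    obtain ⟨K, hK⟩ := trunc A w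
    exact ⟨K + p.natAbs, fun i hi => by simp only [G4]; rw [hK _ (by omega), map_zero, map_zero]⟩
  have f12 := sub_mem f1 f2
  have f34 := sub_mem f3 f4
  let H : ℤ → F3 V := fun n => expL n (G1 - G2) - expR n (G3 - G4)
  have hS : ∀ n, opS (H n) = H (n + 1) := fun n => by
    simp only [H]; rw [map_sub, opS_expL f12, opS_expR f34]
  have hSN : ∀ (j : ℕ) (n : ℤ), (opS ^ j) (H n) = H (n + j) := fun j => by
    induction j with
    | zero => intro n; simp
    | succ j ih => intro n; rw [pow_succ, Module.End.mul_apply, hS, ih]; push_cast; ring_nf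
  have hH0 : ∀ j : ℕ, H ((N1 + j : ℕ) : ℤ) = 0 := fun j => by
    have := hSN (N1 + j) 0
    rw [zero_add] at this
    rw [← this, add_comm, pow_add, Module.End.mul_apply]
    have : (opS ^ N1) (H 0) = 0 := by
      simp only [H, expL_zero, expR_zero]
      have e1 : (opS ^ N1) (G1 - G3) = 0 := by
        funext p k l
        rw [opS_pow]
        exact congrFun (congrFun (h1 (mode C l w)) p) k
      have e2 : (opS ^ N1) (G2 - G4) = 0 := by
        funext p k l
        rw [opS_pow]
        have := mulSub_map (mode C l).toAddMonoidHom N1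
          (fun m n => mode A m (mode B n w) - mode B n (mode A m w))
        rw [h1 w] at this
        simpa [G2, G4] using congrFun (congrFun this p) k
      rw [show G1 - G2 - (G3 - G4) = (G1 - G3) - (G2 - G4) by abel, map_sub, e1, e2, sub_zero]
    rw [this, map_zero]
  have hSH : (opS ^ (N1 + n.natAbs)) (H n) = 0 := by
    rw [hSN]
    have : n + ((N1 + n.natAbs : ℕ) : ℤ) = ((N1 + (n + n.natAbs).toNat : ℕ) : ℤ) := by
      have : |n| = (n.natAbs : ℤ) := Int.abs_eq_natAbs n
      push_cast; omega
    rw [this, hH0]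
  have kill12 : (opQ ^ N2) ((opR ^ N3) (G1 - G2)) = 0 := by
    have e1 : (opR ^ N3) (fun t x y => mode A t (mode B x (mode C y w) - mode C y (mode B x w)))
        = (0 : F3 V) := by
      funext p k l
      rw [opR_pow]
      have := mulSub_map (mode A p).toAddMonoidHom N3
          (fun m n => mode B m (mode C n w) - mode C n (mode B m w))
      rw [h3 w] at this
      simpa using congrFun (congrFun this k) l
    have e2 : (opQ ^ N2) (fun t x y => mode A t (mode C y (mode B x w)) -
        mode C y (mode A t (mode B x w))) = (0 : F3 V) := by
      funext p k l
      rw [opQ_pow]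
      exact congrFun (congrFun (h2 (mode B k w)) p) l
    have e3 : G1 - G2 = (fun t x y => mode A t (mode B x (mode C y w) - mode C y (mode B x w)))
        + (fun t x y => mode A t (mode C y (mode B x w)) - mode C y (mode A t (mode B x w))) := by
      funext t x y; simp [G1, G2]
    rw [e3, map_add, e1, zero_add, ← Module.End.mul_apply,
      ((comm_RQ.pow_left N3).pow_right N2).symm.eq, Module.End.mul_apply, e2, map_zero]
  have kill34 : (opQ ^ N2) ((opR ^ N3) (G3 - G4)) = 0 := by
    have e1 : (opR ^ N3) (fun t x y => mode B x (mode C y (mode A t w)) -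
        mode C y (mode B x (mode A t w))) = (0 : F3 V) := by
      funext p k l
      rw [opR_pow]
      exact congrFun (congrFun (h3 (mode A p w)) k) l
    have e2 : (opQ ^ N2) (fun t x y => mode B x (mode A t (mode C y w) - mode C y (mode A t w)))
        = (0 : F3 V) := by
      funext p k l
      rw [opQ_pow]
      have := mulSub_map (mode B k).toAddMonoidHom N2
          (fun m n => mode A m (mode C n w) - mode C n (mode A m w))
      rw [h2 w] at this
      simpa using congrFun (congrFun this p) l
    have e3 : G3 - G4 = (fun t x y => mode B x (mode C y (mode A t w)) -
        mode C y (mode B x (mode A t w)))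
        + (fun t x y => mode B x (mode A t (mode C y w) - mode C y (mode A t w))) := by
      funext t x y; simp [G3, G4]
    rw [e3, map_add, e1, zero_add, ← Module.End.mul_apply,
      ((comm_RQ.pow_left N3).pow_right N2).symm.eq, Module.End.mul_apply, e2, map_zero]
  have hQH : (opQ ^ N2) ((opR ^ N3) (H n)) = 0 := by
    simp only [H, map_sub (opR ^ N3), map_sub (opQ ^ N2)]
    rw [← (pow_opR_L n N3 _ f12).2, ← (pow_opR_R n N3 _ f34).2,
      ← (pow_opQ_L n N2 _ (pow_opR_L n N3 _ f12).1).2,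
      ← (pow_opQ_R n N2 _ (pow_opR_R n N3 _ f34).1).2, kill12, kill34]
    funext p k l
    simp [expL, expR]
  have hfin : (opR ^ ((N1 + n.natAbs) + N2 + N3)) (H n) = 0 := by
    rw [pow_add, Module.End.mul_apply, opR_eq]
    apply sub_pow_kill _ _ comm_SQ
    · rw [← opR_eq, ← Module.End.mul_apply, ((comm_RS.pow_left N3).pow_right _).symm.eq,
        Module.End.mul_apply, hSH, map_zero]
    · rw [← opR_eq, hQH]
  have hfin' := fun k l => congrFun (congrFun (congrFun hfin 0) k) l
  funext k l
  refine Eq.trans ?_ (hfin' k l)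
  rw [opR_pow]
  refine congrFun (congrFun (congrArg _ ?_) k) l
  clear k l
  funext k l
  simp only [H, Pi.sub_apply]
  rw [expL_sub f1 f2, expR_sub f3 f4]
  obtain ⟨K1, e1⟩ := expL_range f1 n 0 k l
  obtain ⟨K2, e2⟩ := expL_range f2 n 0 k l
  obtain ⟨K3, e3⟩ := expR_range f3 n 0 k l
  obtain ⟨K4, e4⟩ := expR_range f4 n 0 k l
  obtain ⟨a, ha⟩ := trunc A w
  obtain ⟨b, hb⟩ := trunc B w
  obtain ⟨a', ha'⟩ := trunc A (mode C l w)
  obtain ⟨b', hb'⟩ := trunc B (mode C l w)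
  set K := K1 + K2 + K3 + K4 + a + b + a' + b' + k.natAbs with hK
  rw [Pi.sub_apply, Pi.sub_apply, Pi.sub_apply, Pi.sub_apply, Pi.sub_apply, Pi.sub_apply,
    e1 K (by omega), e2 K (by omega), e3 K (by omega), e4 K (by omega),
    resProd_apply_range n k A B w K (fun i hi => ha _ (by omega)) (fun i hi => hb _ (by omega)),
    resProd_apply_range n k A B _ K (fun i hi => ha' _ (by omega)) (fun i hi => hb' _ (by omega)),
    map_sum, ← Finset.sum_sub_distrib, ← Finset.sum_sub_distrib, ← Finset.sum_sub_distrib,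
    ← Finset.sum_sub_distrib]
  refine Finset.sum_congr rfl fun i _ => ?_
  simp only [resTerm, G1, G2, G3, G4, map_zsmul, map_sub, zero_add, add_comm k n]
  module
end dong
end VA
end

noncomputable section

/-- A vertex algebra over `ℂ`: a vertex operator map `Y` with values in fields (so that `u_n v = 0`
for `n` large) and a vacuum vector, satisfying the vacuum and creation properties, translation
covariance `[D, Y(v, x)] = (d/dx) Y(v, x)` for `D w = w_{-2} 1`, and locality. These axioms are
equivalent to those with the Jacobi identity. -/
structure VertexAlgebra (V : Type*) [AddCommGroup V] [Module ℂ V] where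
  /-- the vertex operator map `v ↦ Y(v, x) = ∑ v_n x^(-n-1)` -/
  Y : V →ₗ[ℂ] VertexOperator ℂ V
  /-- the vacuum vector -/
  vac : V
  vac_mode : ∀ n w, VA.mode (Y vac) n w = if n = -1 then w else 0
  creation : ∀ v, VA.mode (Y v) (-1) vac = v
  creation_nonneg : ∀ v n, 0 ≤ n → VA.mode (Y v) n vac = 0
  translation : ∀ v n w, VA.mode (Y (VA.mode (Y v) n w)) (-2) vac =
    VA.mode (Y v) n (VA.mode (Y w) (-2) vac) - n • VA.mode (Y v) (n - 1) w
  locality : ∀ u v, VA.Local (Y u) (Y v)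

namespace VertexAlgebra
variable {V : Type*} [AddCommGroup V] [Module ℂ V]

/-- The product `u_n v` of a vertex algebra. -/
def prod (𝒱 : VertexAlgebra V) (u : V) (n : ℤ) (v : V) : V := VA.mode (𝒱.Y u) n v

/-- A vertex subalgebra: a subspace containing the vacuum and closed under all products. -/
structure IsSubalgebra (𝒱 : VertexAlgebra V) (W : Submodule ℂ V) : Prop where
  vac_mem : 𝒱.vac ∈ W
  prod_mem : ∀ u ∈ W, ∀ v ∈ W, ∀ n : ℤ, 𝒱.prod u n v ∈ W

/-- An ideal of a vertex algebra: a subspace `I` with `v_n w ∈ I` and `w_n v ∈ I` for all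
`v ∈ V`, `w ∈ I` and `n ∈ ℤ`. -/
structure IsIdeal (𝒱 : VertexAlgebra V) (I : Submodule ℂ V) : Prop where
  left_mem : ∀ v, ∀ w ∈ I, ∀ n : ℤ, 𝒱.prod v n w ∈ I
  right_mem : ∀ v, ∀ w ∈ I, ∀ n : ℤ, 𝒱.prod w n v ∈ I

/-- The ideal generated by a set: the intersection of all ideals that contain it. -/
def idealSpan (𝒱 : VertexAlgebra V) (s : Set V) : Submodule ℂ V :=
  sInf {I | 𝒱.IsIdeal I ∧ s ⊆ I}

lemma idealSpan_isIdeal (𝒱 : VertexAlgebra V) (s : Set V) : 𝒱.IsIdeal (𝒱.idealSpan s) where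
  left_mem v w hw n := Submodule.mem_sInf.2 fun I hI =>
    hI.1.left_mem v w (Submodule.mem_sInf.1 hw I hI) n
  right_mem v w hw n := Submodule.mem_sInf.2 fun I hI =>
    hI.1.right_mem v w (Submodule.mem_sInf.1 hw I hI) n

lemma subset_idealSpan (𝒱 : VertexAlgebra V) (s : Set V) : s ⊆ 𝒱.idealSpan s :=
  fun _ hx => Submodule.mem_sInf.2 fun _ hI => hI.2 hx

/-- The vertex operator `Y(u, x)` of an element of a vertex subalgebra, restricted to it. -/
def restrictField (𝒱 : VertexAlgebra V) (W : Submodule ℂ V) (h : 𝒱.IsSubalgebra W) (u : W) :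
    VertexOperator ℂ W :=
  VA.ofModes (fun n => (VA.mode (𝒱.Y u) n).restrict fun v hv => h.prod_mem u u.2 v hv n) fun w => by
    obtain ⟨K, hK⟩ := VA.trunc (𝒱.Y u) w
    exact ⟨K, fun n hn => Subtype.ext (hK n hn)⟩

lemma restrictField_mode (𝒱 : VertexAlgebra V) (W : Submodule ℂ V) (h : 𝒱.IsSubalgebra W)
    (u : W) (n : ℤ) (w : W) :
    (VA.mode (𝒱.restrictField W h u) n w : V) = VA.mode (𝒱.Y u) n w := by
  simp only [restrictField, VA.ofModes_ncoeff]; rfl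

/-- A vertex subalgebra is a vertex algebra, with the restricted vertex operators. -/
def restrict (𝒱 : VertexAlgebra V) (W : Submodule ℂ V) (h : 𝒱.IsSubalgebra W) :
    VertexAlgebra W where
  Y :=
    { toFun := 𝒱.restrictField W h
      map_add' := fun u v => VA.field_ext fun n w => Subtype.ext (by
        rw [VA.mode_add, Submodule.coe_add]
        simp only [restrictField_mode, Submodule.coe_add, map_add, VA.mode_add])
      map_smul' := fun r u => VA.field_ext fun n w => Subtype.ext (by
        rw [RingHom.id_apply, VA.mode_smul, Submodule.coe_smul]
        simp only [restrictField_mode, Submodule.coe_smul, map_smul, VA.mode_smul]) }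
  vac := ⟨𝒱.vac, h.vac_mem⟩
  vac_mode n w := Subtype.ext (by
    change (VA.mode (𝒱.restrictField W h _) n w : V) = _
    rw [restrictField_mode, 𝒱.vac_mode]
    split_ifs <;> rfl)
  creation v := Subtype.ext (by
    change (VA.mode (𝒱.restrictField W h _) _ _ : V) = _
    rw [restrictField_mode, 𝒱.creation])
  creation_nonneg v n hn := Subtype.ext (by
    change (VA.mode (𝒱.restrictField W h _) _ _ : V) = _
    rw [restrictField_mode, 𝒱.creation_nonneg _ _ hn]; rfl)
  translation v n w := Subtype.ext (by
    change (VA.mode (𝒱.restrictField W h (VA.mode (𝒱.restrictField W h _) _ _)) _ _ : V) =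
      (VA.mode (𝒱.restrictField W h _) _ (VA.mode (𝒱.restrictField W h _) _ _) : V) -
      n • (VA.mode (𝒱.restrictField W h _) _ _ : V)
    simp only [restrictField_mode]
    exact 𝒱.translation _ _ _)
  locality u v := by
    obtain ⟨K, hK⟩ := 𝒱.locality u v
    refine ⟨K, fun w => ?_⟩
    have h1 := VA.mulSub_map W.subtype.toAddMonoidHom K (fun m n =>
      VA.mode (𝒱.restrictField W h u) m (VA.mode (𝒱.restrictField W h v) n w) -
      VA.mode (𝒱.restrictField W h v) n (VA.mode (𝒱.restrictField W h u) m w))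
    have h2 := hK w
    funext m n
    apply Subtype.ext
    have h3 := congrFun (congrFun h1 m) n
    simp only [LinearMap.toAddMonoidHom_coe, Submodule.subtype_apply, Submodule.coe_sub,
      restrictField_mode, h2] at h3
    exact h3.symm

lemma restrict_prod (𝒱 : VertexAlgebra V) (W : Submodule ℂ V) (h : 𝒱.IsSubalgebra W)
    (u v : W) (n : ℤ) : ((𝒱.restrict W h).prod u n v : V) = 𝒱.prod u n v :=
  𝒱.restrictField_mode W h u n v

end VertexAlgebra
end

noncomputable section
open TensorProduct
namespace AffineSl2
attribute [local instance 100] LieRing.ofAssociativeRing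
attribute [local instance 100] LieAlgebra.ofAssociativeAlgebra

/-- The Lie algebra `sl(2)` over `ℂ`. -/
abbrev sl2 := LieAlgebra.SpecialLinear.sl (Fin 2) ℂ

/-- The root vector `x_α`, the matrix with entry `1` in the upper right corner. -/
def xα : sl2 := LieAlgebra.SpecialLinear.single 0 1 (by decide) 1

/-- The invariant form `⟨a, b⟩ = tr (a b)`. -/
def form : LinearMap.BilinForm ℂ sl2 :=
  LinearMap.mk₂ ℂ (fun a b => Matrix.trace (a.1 * b.1))
    (fun a b c => by simp [add_mul]) (fun r a b => by simp)
    (fun a b c => by simp [mul_add]) (fun r a b => by simp)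

lemma form_apply (a b : sl2) : form a b = Matrix.trace (a.1 * b.1) := rfl

lemma form_symm : form.IsSymm := ⟨fun a b => Matrix.trace_mul_comm a.1 b.1⟩

lemma form_invariant : form.lieInvariant sl2 := fun a b c => by
  have h := Matrix.trace_mul_cycle a.1 b.1 c.1
  simp only [form_apply, LieAlgebra.SpecialLinear.sl_bracket, sub_mul, mul_sub, Matrix.trace_sub,
    ← mul_assoc]
  have h1 := Matrix.trace_mul_cycle b.1 c.1 a.1
  rw [h1]; ring

/-- The 2-cocycle `(a ⊗ t^m, b ⊗ t^n) ↦ m ⟨a, b⟩ δ_{m+n,0}` on `sl(2) ⊗ ℂ[t, t⁻¹]`. -/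
def cocycle := LieAlgebra.LoopAlgebra.twoCocycleOfBilinear ℂ ℤ sl2 (-form)
  (fun a b c => by simp [form_invariant a b c]) ⟨fun a b => by simpa using form_symm.eq a b⟩

/-- The affine Lie algebra `sl(2) ⊗ ℂ[t, t⁻¹] ⊕ ℂ k`. -/
abbrev Affine := LieAlgebra.ofTwoCocycle cocycle

/-- The element `a ⊗ t^n`. -/
def loop (a : sl2) (n : ℤ) : Affine :=
  LieAlgebra.ofProd cocycle (AddMonoidAlgebra.single n 1 ⊗ₜ a, 0)

/-- The central element `k`. -/
def central : Affine :=
  LieAlgebra.ofProd cocycle (0, (TrivialLieModule.equiv ℂ _ ℂ).symm 1)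

lemma residue_apply (a b : sl2) (m n : ℤ) :
    LieAlgebra.LoopAlgebra.residuePairing ℂ ℤ sl2 (-form)
      (AddMonoidAlgebra.single m 1 ⊗ₜ a) (AddMonoidAlgebra.single n 1 ⊗ₜ b) =
      if m + n = 0 then (m : ℂ) * form a b else 0 := by
  rw [LieAlgebra.LoopAlgebra.residuePairing_apply_apply,
    LieAlgebra.LoopAlgebra.toFinsupp_single_tmul, LieAlgebra.LoopAlgebra.toFinsupp_single_tmul,
    Finsupp.sum_single_index (by simp), Finsupp.single_apply]
  by_cases h : m + n = 0
  · have : m = -n := by omega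
    subst this
    simp
  · rw [if_neg h, if_neg (by omega)]; simp

lemma loop_bracket (a b : sl2) (m n : ℤ) :
    ⁅loop a m, loop b n⁆ =
      loop ⁅a, b⁆ (m + n) + if m + n = 0 then ((m : ℂ) * form a b) • central else 0 := by
  have h := residue_apply a b m n
  rw [LieAlgebra.bracket_ofTwoCocycle]
  apply (LieAlgebra.ofProd cocycle).symm.injective
  rw [Equiv.symm_apply_apply, LieAlgebra.of_symm_add]
  have h1 : ⁅(AddMonoidAlgebra.single m 1 ⊗ₜ a : LieAlgebra.loopAlgebra ℂ ℤ sl2),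
      (AddMonoidAlgebra.single n 1 ⊗ₜ b : LieAlgebra.loopAlgebra ℂ ℤ sl2)⁆ =
      (AddMonoidAlgebra.single (m + n) 1 ⊗ₜ ⁅a, b⁆ : LieAlgebra.loopAlgebra ℂ ℤ sl2) := by
    rw [LieAlgebra.ExtendScalars.bracket_tmul, AddMonoidAlgebra.single_mul_single, mul_one]
  have h2 : (LieAlgebra.ofProd cocycle).symm
      (if m + n = 0 then ((m : ℂ) * form a b) • central else 0) =
      (0, (TrivialLieModule.equiv ℂ _ ℂ).symm (if m + n = 0 then (m : ℂ) * form a b else 0)) := by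
    split_ifs
    · rw [LieAlgebra.of_symm_smul, central, Equiv.symm_apply_apply, Prod.smul_mk, smul_zero,
        ← map_smul, smul_eq_mul, mul_one]
    · rfl
  rw [h2]
  simp only [loop, Equiv.symm_apply_apply, trivial_lie_zero, add_zero, sub_zero, Prod.mk_add_mk,
    zero_add, h1, ← h]
  rfl

lemma central_bracket (x : Affine) : ⁅central, x⁆ = 0 := by
  rw [LieAlgebra.bracket_ofTwoCocycle]
  apply (LieAlgebra.ofProd cocycle).symm.injective
  simp [central, trivial_lie_zero]

/-- A linear map on the affine Lie algebra, given by its values on `a ⊗ t^n` and on `k`. -/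
def affLift {M : Type*} [AddCommGroup M] [Module ℂ M] (f : ℤ → sl2 →ₗ[ℂ] M) (c : M) :
    Affine →ₗ[ℂ] M where
  toFun x :=
    Finsupp.lsum ℂ f (LieAlgebra.LoopAlgebra.toFinsupp ℂ ℤ sl2
      ((LieAlgebra.ofProd cocycle).symm x).1) +
    TrivialLieModule.equiv ℂ _ ℂ ((LieAlgebra.ofProd cocycle).symm x).2 • c
  map_add' x y := by
    simp only [LieAlgebra.of_symm_add, Prod.fst_add, Prod.snd_add, map_add, add_smul]; abel
  map_smul' r x := by
    simp only [LieAlgebra.of_symm_smul, Prod.smul_fst, Prod.smul_snd, map_smul, smul_add,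
      RingHom.id_apply, smul_assoc]

lemma affLift_loop {M : Type*} [AddCommGroup M] [Module ℂ M] (f : ℤ → sl2 →ₗ[ℂ] M) (c : M)
    (a : sl2) (n : ℤ) : affLift f c (loop a n) = f n a := by
  change Finsupp.lsum ℂ f (LieAlgebra.LoopAlgebra.toFinsupp ℂ ℤ sl2
    (AddMonoidAlgebra.single n 1 ⊗ₜ a)) + (0 : ℂ) • c = _
  rw [LieAlgebra.LoopAlgebra.toFinsupp_single_tmul, zero_smul, add_zero, Finsupp.lsum_single]

lemma affLift_central {M : Type*} [AddCommGroup M] [Module ℂ M] (f : ℤ → sl2 →ₗ[ℂ] M) (c : M) :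
    affLift f c central = c := by
  simp [affLift, central]

lemma affine_induction {P : Affine → Prop} (hl : ∀ a n, P (loop a n)) (hc : P central)
    (hadd : ∀ x y, P x → P y → P (x + y)) (hs : ∀ (r : ℂ) x, P x → P (r • x)) (x : Affine) :
    P x := by
  obtain ⟨f, c⟩ := x
  have h0 : P 0 := by simpa using hs 0 _ hc
  have h1 : P (LieAlgebra.ofProd cocycle (f, 0)) := by
    obtain ⟨g, rfl⟩ := (LieAlgebra.LoopAlgebra.toFinsupp ℂ ℤ sl2).symm.surjective f
    induction g using Finsupp.induction_linear with
    | zero => rw [map_zero]; exact h0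
    | add g h hg hh =>
      have := hadd _ _ hg hh
      rw [← LieAlgebra.of_add] at this
      simpa using this
    | single n a =>
      rw [LieAlgebra.LoopAlgebra.toFinsupp_symm_single]
      exact hl a n
  have h2 : P (LieAlgebra.ofProd cocycle (0, c)) := by
    have := hs (TrivialLieModule.equiv ℂ _ ℂ c) _ hc
    rw [central, ← LieAlgebra.of_smul, Prod.smul_mk, smul_zero, ← map_smul, smul_eq_mul, mul_one,
      LinearEquiv.symm_apply_apply] at this
    exact this
  have := hadd _ _ h1 h2
  rw [← LieAlgebra.of_add] at this
  simpa using! this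

lemma affLift_lie {A : Type*} [Ring A] [Algebra ℂ A] (f : ℤ → sl2 →ₗ[ℂ] A)
    (hf : ∀ a b m n, f m a * f n b - f n b * f m a =
      f (m + n) ⁅a, b⁆ + if m + n = 0 then ((m : ℂ) * form a b) • (1 : A) else 0) (x y : Affine) :
    affLift f 1 ⁅x, y⁆ = affLift f 1 x * affLift f 1 y - affLift f 1 y * affLift f 1 x := by
  induction x using affine_induction with
  | hadd x x' hx hx' => rw [add_lie, map_add, map_add, hx, hx', add_mul, mul_add]; abel
  | hs r x hx => rw [smul_lie, map_smul, map_smul, hx, smul_mul_assoc, mul_smul_comm, smul_sub]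
  | hc => rw [central_bracket, map_zero, affLift_central]; simp
  | hl a m =>
    induction y using affine_induction with
    | hadd x x' hx hx' => rw [lie_add, map_add, map_add, hx, hx', add_mul, mul_add]; abel
    | hs r x hx => rw [lie_smul, map_smul, map_smul, hx, smul_mul_assoc, mul_smul_comm, smul_sub]
    | hc => rw [← lie_skew, central_bracket, neg_zero, map_zero, affLift_central]; simp
    | hl b n =>
      rw [loop_bracket, map_add, affLift_loop, affLift_loop, affLift_loop, hf]
      congr 1
      split_ifs
      · rw [map_smul, affLift_central]
      · rw [map_zero]

/-- A representation of the affine Lie algebra with `k` acting as `1`, given by operators that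
satisfy the affine commutation relations. -/
def affLiftHom {A : Type*} [Ring A] [Algebra ℂ A] (f : ℤ → sl2 →ₗ[ℂ] A)
    (hf : ∀ a b m n, f m a * f n b - f n b * f m a =
      f (m + n) ⁅a, b⁆ + if m + n = 0 then ((m : ℂ) * form a b) • (1 : A) else 0) :
    Affine →ₗ⁅ℂ⁆ A :=
  { affLift f 1 with
    map_lie' := fun {x y} => by
      rw [LieRing.of_associative_ring_bracket]; exact affLift_lie f hf x y }

lemma affLiftHom_apply {A : Type*} [Ring A] [Algebra ℂ A] (f : ℤ → sl2 →ₗ[ℂ] A) (hf) (x : Affine) :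
    affLiftHom f hf x = affLift f 1 x := rfl
end AffineSl2
end

noncomputable section
namespace AffineSl2
open VA
attribute [local instance 100] LieRing.ofAssociativeRing
attribute [local instance 100] LieAlgebra.ofAssociativeAlgebra

/-- The universal enveloping algebra of the affine Lie algebra. -/
abbrev UAff := UniversalEnvelopingAlgebra ℂ Affine

/-- The left ideal of `U(ĝ)` generated by `a ⊗ t^n` for `n ≥ 0` and by `k - 1`. -/
def vacuumIdeal : Submodule UAff UAff :=
  Submodule.span UAff ({x | ∃ (a : sl2) (n : ℤ), 0 ≤ n ∧ x = UniversalEnvelopingAlgebra.ι ℂ (loop a n)} ∪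
    {UniversalEnvelopingAlgebra.ι ℂ central - 1})

/-- The generalized Verma module `N(Λ₀)`: the `ĝ`-module induced from the one-dimensional module of
`ĝ_{≥0} = sl(2) ⊗ ℂ[t] ⊕ ℂ k` on which `sl(2) ⊗ ℂ[t]` acts by `0` and `k` acts by `1`. -/
def N := UAff ⧸ vacuumIdeal

instance : AddCommGroup N := inferInstanceAs (AddCommGroup (UAff ⧸ vacuumIdeal))
instance : Module UAff N := inferInstanceAs (Module UAff (UAff ⧸ vacuumIdeal))
instance : Module ℂ N := inferInstanceAs (Module ℂ (UAff ⧸ vacuumIdeal))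
instance : IsScalarTower ℂ UAff N := inferInstanceAs (IsScalarTower ℂ UAff (UAff ⧸ vacuumIdeal))

/-- The quotient map `U(ĝ) → N(Λ₀)`, `u ↦ u · v`. -/
def toN : UAff →ₗ[UAff] N := Submodule.mkQ vacuumIdeal

lemma toN_surjective : Function.Surjective toN := Submodule.mkQ_surjective _

lemma toN_eq_zero {u : UAff} (h : u ∈ vacuumIdeal) : toN u = 0 :=
  (Submodule.Quotient.mk_eq_zero _).2 h

/-- The highest weight vector of `N(Λ₀)`. -/
def vac : N := toN 1

lemma toN_mul (u v : UAff) : toN (u * v) = u • toN v := toN.map_smul u v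

/-- The operator `a(n)` by which `a ⊗ t^n` acts on `N(Λ₀)`. -/
def op (a : sl2) (n : ℤ) : Module.End ℂ N :=
  Algebra.lsmul ℂ ℂ N (UniversalEnvelopingAlgebra.ι ℂ (loop a n))

lemma op_apply (a : sl2) (n : ℤ) (w : N) :
    op a n w = UniversalEnvelopingAlgebra.ι ℂ (loop a n) • w := rfl

lemma U_induction {L : Type*} [LieRing L] [LieAlgebra ℂ L]
    (S : Submodule ℂ (UniversalEnvelopingAlgebra ℂ L)) (h1 : 1 ∈ S)
    (hm : ∀ x : L, ∀ u ∈ S, UniversalEnvelopingAlgebra.ι ℂ x * u ∈ S)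
    (u : UniversalEnvelopingAlgebra ℂ L) : u ∈ S := by
  let A := Algebra.adjoin ℂ (Set.range (UniversalEnvelopingAlgebra.ι ℂ (L := L)))
  let f : L →ₗ⁅ℂ⁆ A :=
    { toFun := fun x => ⟨UniversalEnvelopingAlgebra.ι ℂ x, Algebra.subset_adjoin ⟨x, rfl⟩⟩
      map_add' := fun x y => Subtype.ext (by simp)
      map_smul' := fun r x => Subtype.ext (by simp)
      map_lie' := fun {x y} => Subtype.ext (by
        simp [LieRing.of_associative_ring_bracket]) }
  have hid : A.val.comp (UniversalEnvelopingAlgebra.lift ℂ f) = AlgHom.id ℂ _ := by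
    ext x
    simp [f]
  have hu : u ∈ A := by
    have := congrArg (fun g => g u) hid
    simp only [AlgHom.comp_apply, AlgHom.id_apply] at this
    rw [← this]
    exact (UniversalEnvelopingAlgebra.lift ℂ f u).2
  have key : ∀ v ∈ S, u * v ∈ S := by
    induction hu using Algebra.adjoin_induction with
    | mem x hx => obtain ⟨y, rfl⟩ := hx; exact fun v hv => hm y v hv
    | algebraMap r => intro v hv; rw [← Algebra.smul_def]; exact S.smul_mem r hv
    | add x y _ _ hx hy => intro v hv; rw [add_mul]; exact S.add_mem (hx v hv) (hy v hv)
    | mul x y _ _ hx hy => intro v hv; rw [mul_assoc]; exact hx _ (hy v hv)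
  simpa using key 1 h1

lemma op_vac (a : sl2) (n : ℤ) (hn : 0 ≤ n) : op a n vac = 0 := by
  rw [op_apply, vac, ← toN_mul, mul_one]
  apply toN_eq_zero
  exact Submodule.subset_span (Or.inl ⟨a, n, hn, rfl⟩)

lemma central_comm (u : UAff) : UniversalEnvelopingAlgebra.ι ℂ central * u =
    u * UniversalEnvelopingAlgebra.ι ℂ central := by
  let c : UAff := UniversalEnvelopingAlgebra.ι ℂ central
  have key := U_induction (LinearMap.ker (LinearMap.mulLeft ℂ c - LinearMap.mulRight ℂ c))
    (by simp) (fun x u hu => by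
      simp only [LinearMap.mem_ker, LinearMap.sub_apply, LinearMap.mulLeft_apply,
        LinearMap.mulRight_apply, sub_eq_zero] at hu ⊢
      have h := (UniversalEnvelopingAlgebra.ι ℂ (L := Affine)).map_lie central x
      rw [central_bracket, map_zero, LieRing.of_associative_ring_bracket, eq_comm, sub_eq_zero] at h
      rw [← mul_assoc, h, mul_assoc, hu, mul_assoc]) u
  exact sub_eq_zero.1 key

lemma central_smul (w : N) : UniversalEnvelopingAlgebra.ι ℂ central • w = w := by
  obtain ⟨u, rfl⟩ := toN_surjective w
  rw [← toN_mul, central_comm, ← sub_eq_zero, ← map_sub]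
  have : u * UniversalEnvelopingAlgebra.ι ℂ central - u =
      u • (UniversalEnvelopingAlgebra.ι ℂ central - 1) := by
    rw [smul_eq_mul, mul_sub, mul_one]
  rw [this]
  exact toN_eq_zero (Submodule.smul_mem _ _ (Submodule.subset_span (Or.inr rfl)))

lemma N_induction (S : Submodule ℂ N) (h1 : vac ∈ S) (hm : ∀ a n, ∀ w ∈ S, op a n w ∈ S) (w : N) :
    w ∈ S := by
  obtain ⟨u, rfl⟩ := toN_surjective w
  let f : UAff →ₗ[ℂ] N := toN.restrictScalars ℂ
  refine U_induction (S.comap f) h1 (fun x v hv => ?_) u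
  have e : f (UniversalEnvelopingAlgebra.ι ℂ x * v) = UniversalEnvelopingAlgebra.ι ℂ x • f v :=
    toN_mul _ _
  rw [Submodule.mem_comap] at hv ⊢
  rw [e]
  induction x using affine_induction with
  | hl a n => exact hm a n _ hv
  | hc => rw [central_smul]; exact hv
  | hadd x y hx hy => rw [map_add, add_smul]; exact S.add_mem (hx rfl) (hy rfl)
  | hs r x hx => rw [map_smul, smul_assoc]; exact S.smul_mem r (hx rfl)

lemma op_comm (a b : sl2) (m n : ℤ) (w : N) :
    op a m (op b n w) - op b n (op a m w) =
      op ⁅a, b⁆ (m + n) w + if m + n = 0 then ((m : ℂ) * form a b) • w else 0 := by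
  have h := (UniversalEnvelopingAlgebra.ι ℂ (L := Affine)).map_lie (loop a m) (loop b n)
  rw [LieRing.of_associative_ring_bracket, loop_bracket, map_add] at h
  rw [op_apply, op_apply, op_apply, op_apply, op_apply, ← SemigroupAction.mul_smul,
    ← SemigroupAction.mul_smul, ← sub_smul, ← h, add_smul]
  congr 1
  split_ifs
  · rw [map_smul, smul_assoc, central_smul]
  · rw [map_zero, zero_smul]

lemma loop_add (a b : sl2) (n : ℤ) : loop (a + b) n = loop a n + loop b n := by
  simp [loop, TensorProduct.tmul_add, ← LieAlgebra.of_add]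

lemma loop_smul (r : ℂ) (a : sl2) (n : ℤ) : loop (r • a) n = r • loop a n := by
  simp [loop, TensorProduct.tmul_smul, ← LieAlgebra.of_smul]

lemma op_trunc (w : N) : ∃ K : ℕ, ∀ a, ∀ n : ℤ, K ≤ n → op a n w = 0 := by
  let S : Submodule ℂ N :=
    { carrier := {w | ∃ K : ℕ, ∀ a, ∀ n : ℤ, K ≤ n → op a n w = 0}
      zero_mem' := ⟨0, fun a n _ => map_zero _⟩
      add_mem' := by
        rintro v w ⟨K, hK⟩ ⟨L, hL⟩
        exact ⟨K + L, fun a n hn => by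
          rw [map_add, hK a n (by omega), hL a n (by omega), add_zero]⟩
      smul_mem' := by
        rintro r w ⟨K, hK⟩
        exact ⟨K, fun a n hn => by rw [map_smul, hK a n hn, smul_zero]⟩ }
  refine N_induction S ⟨0, fun a n hn => op_vac a n (by simpa using hn)⟩ ?_ w
  rintro b j w ⟨K, hK⟩
  refine ⟨K + j.natAbs + 1, fun a n hn => ?_⟩
  have := op_comm a b n j w
  rw [hK a n (by omega), hK _ (n + j) (by omega), map_zero, sub_zero, if_neg (by omega),
    add_zero] at this
  exact this

/-- The field `a(x) = ∑ a(n) x^(-n-1)` on `N(Λ₀)`. -/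
def current (a : sl2) : VertexOperator ℂ N :=
  ofModes (op a) fun w => by
    obtain ⟨K, hK⟩ := op_trunc w
    exact ⟨K, hK a⟩

lemma current_mode (a : sl2) (n : ℤ) : mode (current a) n = op a n := ofModes_ncoeff _ _ _

def currentₗ : sl2 →ₗ[ℂ] VertexOperator ℂ N where
  toFun := current
  map_add' a b := field_ext fun n w => by
    rw [mode_add]
    simp only [current_mode, op_apply, loop_add, map_add, add_smul]
  map_smul' r a := field_ext fun n w => by
    rw [RingHom.id_apply, mode_smul]
    simp only [current_mode, op_apply, loop_smul, map_smul, smul_assoc]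

lemma field_comm (a b : sl2) (m n : ℤ) :
    ((resProdₗ m).comp currentₗ a : Module.End ℂ (VertexOperator ℂ N)) *
      ((resProdₗ n).comp currentₗ b : Module.End ℂ (VertexOperator ℂ N)) -
      ((resProdₗ n).comp currentₗ b : Module.End ℂ (VertexOperator ℂ N)) *
      ((resProdₗ m).comp currentₗ a : Module.End ℂ (VertexOperator ℂ N)) =
      (resProdₗ (m + n)).comp currentₗ ⁅a, b⁆ +
      if m + n = 0 then ((m : ℂ) * form a b) • (1 : Module.End ℂ (VertexOperator ℂ N)) else 0 := by
  refine LinearMap.ext fun D => ?_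
  have := resProd_commutator (current a) (current b) (current ⁅a, b⁆) D (form a b)
    (fun i j w => by simp only [current_mode]; exact op_comm a b i j w) m n
  refine this.trans ?_
  split_ifs <;> rfl

/-- The action of `ĝ` on the space of all fields on `N(Λ₀)`: `a ⊗ t^n` acts as the residue product
`a(x)_n -`, and `k` acts as `1`. -/
def fieldAction : Affine →ₗ⁅ℂ⁆ Module.End ℂ (VertexOperator ℂ N) :=
  affLiftHom (fun n => (resProdₗ n).comp currentₗ) field_comm

lemma fieldAction_loop (a : sl2) (n : ℤ) (D : VertexOperator ℂ N) :
    fieldAction (loop a n) D = resProd n (current a) D := by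
  have h : fieldAction (loop a n) = (resProdₗ n).comp currentₗ a :=
    affLift_loop (M := Module.End ℂ (VertexOperator ℂ N)) _ _ a n
  rw [h]; rfl

lemma fieldAction_central (D : VertexOperator ℂ N) : fieldAction central D = D := by
  have h : fieldAction central = 1 :=
    affLift_central (M := Module.End ℂ (VertexOperator ℂ N)) _ _
  rw [h]; rfl

/-- The identity field. -/
def idField : VertexOperator ℂ N :=
  ofModes (fun n => if n = -1 then 1 else 0) fun w =>
    ⟨0, fun n hn => by rw [if_neg (by omega)]; rfl⟩

lemma idField_mode (n : ℤ) (w : N) : mode idField n w = if n = -1 then w else 0 := by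
  rw [idField, ofModes_ncoeff]; split_ifs <;> rfl

lemma resProd_idField (a : sl2) (n : ℤ) (hn : 0 ≤ n) : resProd n (current a) idField = 0 := by
  obtain ⟨n, rfl⟩ := Int.eq_ofNat_of_zero_le hn
  exact resProd_of_commute (fun m n w => by
    rw [idField_mode, idField_mode]; split_ifs <;> simp) n

/-- The map `U(ĝ) → (fields)`, `u ↦ u · id`. -/
def preY : UAff →ₗ[ℂ] VertexOperator ℂ N where
  toFun u := UniversalEnvelopingAlgebra.lift ℂ fieldAction u idField
  map_add' u v := by rw [map_add]; rfl
  map_smul' r u := by rw [map_smul]; rfl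

lemma preY_mul (u v : UAff) :
    preY (u * v) = UniversalEnvelopingAlgebra.lift ℂ fieldAction u (preY v) := by
  change UniversalEnvelopingAlgebra.lift ℂ fieldAction (u * v) idField = _
  rw [map_mul]; rfl

lemma preY_one : preY 1 = idField := by
  change UniversalEnvelopingAlgebra.lift ℂ fieldAction 1 idField = _
  rw [map_one]; rfl

lemma preY_ι_mul (x : Affine) (v : UAff) :
    preY (UniversalEnvelopingAlgebra.ι ℂ x * v) = fieldAction x (preY v) := by
  rw [preY_mul, UniversalEnvelopingAlgebra.lift_ι_apply]

lemma preY_vacuumIdeal : vacuumIdeal.restrictScalars ℂ ≤ LinearMap.ker preY := by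
  intro u hu
  rw [Submodule.restrictScalars_mem] at hu
  rw [LinearMap.mem_ker]
  induction hu using Submodule.span_induction with
  | zero => exact map_zero _
  | add x y _ _ hx hy => rw [map_add, hx, hy, add_zero]
  | smul r x _ hx => rw [smul_eq_mul, preY_mul, hx, map_zero]
  | mem x hx =>
    rcases hx with ⟨a, n, hn, rfl⟩ | rfl
    · rw [← mul_one (UniversalEnvelopingAlgebra.ι ℂ (loop a n)), preY_ι_mul, preY_one,
        fieldAction_loop, resProd_idField a n hn]
    · rw [map_sub, ← mul_one (UniversalEnvelopingAlgebra.ι ℂ central), preY_ι_mul, preY_one,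
        fieldAction_central, sub_self]

/-- The vertex operator map of `N(Λ₀)`: the unique `ĝ`-module map from `N(Λ₀)` to fields that sends
the vacuum to the identity field. Equivalently, `Y(1, x) = 1` and
`Y(a(n) u, x) = a(x)_n Y(u, x)` for all `a`, `n`, `u`. -/
def Y : N →ₗ[ℂ] VertexOperator ℂ N :=
  (Submodule.liftQ (vacuumIdeal.restrictScalars ℂ) preY preY_vacuumIdeal).comp
    (Submodule.Quotient.restrictScalarsEquiv ℂ vacuumIdeal).symm.toLinearMap

lemma Y_toN (u : UAff) : Y (toN u) = preY u := rfl

lemma Y_vac : Y vac = idField := by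
  rw [vac, Y_toN, preY_one]

lemma Y_op (a : sl2) (n : ℤ) (u : N) : Y (op a n u) = resProd n (current a) (Y u) := by
  obtain ⟨u, rfl⟩ := toN_surjective u
  rw [op_apply, ← toN_mul, Y_toN, Y_toN, preY_ι_mul, fieldAction_loop]
end AffineSl2
end

noncomputable section
namespace AffineSl2
open VA
attribute [local instance 100] LieRing.ofAssociativeRing
attribute [local instance 100] LieAlgebra.ofAssociativeAlgebra

lemma mode_zero (n : ℤ) (w : N) : mode (0 : VertexOperator ℂ N) n w = 0 := by simp [mode]

lemma Y_op_vac (a : sl2) (n k : ℤ) (u : N) (K : ℕ)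
    (h : ∀ i : ℕ, K ≤ i → mode (Y u) (k + i) vac = 0) :
    mode (Y (op a n u)) k vac =
      ∑ i ∈ Finset.range K, bc n i • op a (n - i) (mode (Y u) (k + i) vac) := by
  rw [Y_op, resProd_apply_range n k _ _ vac K
    (fun i _ => by rw [current_mode, op_vac a i (by omega)]) h]
  refine Finset.sum_congr rfl fun i _ => ?_
  rw [resTerm, current_mode, current_mode, op_vac a i (by omega), map_zero, smul_zero, sub_zero]

lemma Y_creation (u : N) :
    mode (Y u) (-1) vac = u ∧ ∀ n : ℤ, 0 ≤ n → mode (Y u) n vac = 0 := by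
  let S : Submodule ℂ N :=
    { carrier := {u | mode (Y u) (-1) vac = u ∧ ∀ n : ℤ, 0 ≤ n → mode (Y u) n vac = 0}
      zero_mem' := by
        refine ⟨?_, fun n _ => ?_⟩ <;> rw [map_zero, mode_zero]
      add_mem' := by
        rintro u v ⟨h1, h2⟩ ⟨h3, h4⟩
        refine ⟨?_, fun n hn => ?_⟩
        · rw [map_add, mode_add, h1, h3]
        · rw [map_add, mode_add, h2 n hn, h4 n hn, add_zero]
      smul_mem' := by
        rintro r u ⟨h1, h2⟩
        refine ⟨?_, fun n hn => ?_⟩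
        · rw [map_smul, mode_smul, h1]
        · rw [map_smul, mode_smul, h2 n hn, smul_zero] }
  refine N_induction S ⟨?_, fun n hn => ?_⟩ ?_ u
  · rw [Y_vac, idField_mode, if_pos rfl]
  · rw [Y_vac, idField_mode, if_neg (by omega)]
  · rintro a n u ⟨h1, h2⟩
    refine ⟨?_, fun k hk => ?_⟩
    · rw [Y_op_vac a n (-1) u 1 fun i hi => h2 _ (by omega)]
      simp [bc_zero, h1]
    · rw [Y_op_vac a n k u 0 fun i hi => h2 _ (by omega)]
      simp

/-- The translation operator `D w = w_{-2} 1`. -/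
def transl : Module.End ℂ N where
  toFun w := mode (Y w) (-2) vac
  map_add' v w := by rw [map_add, mode_add]
  map_smul' r w := by rw [map_smul, mode_smul]; rfl

lemma transl_apply (w : N) : transl w = mode (Y w) (-2) vac := rfl

lemma transl_op (a : sl2) (n : ℤ) (u : N) :
    transl (op a n u) = op a n (transl u) - n • op a (n - 1) u := by
  have h := Y_creation u
  rw [transl_apply, Y_op_vac a n (-2) u 2 fun i hi => h.2 _ (by omega)]
  rw [Finset.sum_range_succ, Finset.sum_range_one, bc_zero]
  have : bc n 1 = -n := by simp [bc]
  rw [this]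
  have e : (-2 + ((1 : ℕ) : ℤ)) = -1 := by norm_num
  rw [e, h.1]
  simp [transl_apply, sub_eq_add_neg]

lemma Y_translation (u : N) (k : ℤ) (w : N) :
    transl (mode (Y u) k w) = mode (Y u) k (transl w) - k • mode (Y u) (k - 1) w := by
  let S : Submodule ℂ N :=
    { carrier := {u | ∀ (k : ℤ) (w : N),
        transl (mode (Y u) k w) = mode (Y u) k (transl w) - k • mode (Y u) (k - 1) w}
      zero_mem' := by
        intro k w
        rw [map_zero, mode_zero, mode_zero, mode_zero, map_zero, smul_zero, sub_zero]
      add_mem' := by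
        intro u v hu hv k w
        rw [map_add, mode_add, mode_add, mode_add, map_add, hu, hv, smul_add]; abel
      smul_mem' := by
        intro r u hu k w
        rw [map_smul, mode_smul, mode_smul, mode_smul, map_smul, hu, smul_sub, smul_comm r k] }
  refine N_induction S ?_ ?_ u k w
  · intro k w
    rw [Y_vac, idField_mode, idField_mode, idField_mode]
    split_ifs with h1 h2 h2
    · omega
    · simp
    · have : k = 0 := by omega
      simp [this]
    · simp
  · intro a n u hu k w
    obtain ⟨K1, h1⟩ := trunc (current a) w
    obtain ⟨K2, h2⟩ := trunc (Y u) w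
    obtain ⟨K3, h3⟩ := trunc (current a) (transl w)
    obtain ⟨K4, h4⟩ := trunc (Y u) (transl w)
    set K := K1 + K2 + K3 + K4 + k.natAbs + 2 with hK
    rw [Y_op, resProd_apply_range n k _ _ w K (fun i _ => h1 _ (by omega))
        (fun i _ => h2 _ (by omega)),
      resProd_apply_range n k _ _ (transl w) K (fun i _ => h3 _ (by omega))
        (fun i _ => h4 _ (by omega)),
      resProd_apply_range n (k - 1) _ _ w K (fun i _ => h1 _ (by omega))
        (fun i _ => h2 _ (by omega)),
      map_sum, ← sub_eq_zero, Finset.smul_sum, ← Finset.sum_sub_distrib, ← Finset.sum_sub_distrib]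
    let T : ℕ → N := fun i => (bc n i * i) • (op a (n - i) (mode (Y u) (k + i - 1) w) -
      sg n • mode (Y u) (n + k - i) (op a (i - 1) w))
    have hT : ∀ i ∈ Finset.range K, transl (resTerm n k (current a) (Y u) w i) -
        (resTerm n k (current a) (Y u) (transl w) i -
          k • resTerm n (k - 1) (current a) (Y u) w i) = T (i + 1) - T i := by
      intro i _
      have hu' : ∀ (k : ℤ) (w : N),
        transl (mode (Y u) k w) = mode (Y u) k (transl w) - k • mode (Y u) (k - 1) w := hu
      have hb := bc_mul n i
      have hb' : bc n (i + 1) * ((i + 1 : ℕ) : ℤ) = - (bc n i * (n - i)) := by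
        push_cast; linarith
      simp only [T, resTerm, current_mode, map_zsmul, map_sub, transl_op, hu', hb']
      have e1 : n - ((i + 1 : ℕ) : ℤ) = n - i - 1 := by push_cast; ring
      have e2 : k + ((i + 1 : ℕ) : ℤ) - 1 = k + i := by push_cast; ring
      have e3 : n + k - ((i + 1 : ℕ) : ℤ) = n + k - i - 1 := by push_cast; ring
      have e4 : ((i + 1 : ℕ) : ℤ) - 1 = i := by push_cast; ring
      have e5 : k - 1 + (i : ℤ) = k + i - 1 := by ring
      have e6 : n + (k - 1) - (i : ℤ) = n + k - i - 1 := by ring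
      rw [e1, e2, e3, e4, e5, e6]
      module
    rw [Finset.sum_congr rfl hT, Finset.sum_range_sub]
    have hw : op a ((K : ℤ) - 1) w = 0 := by rw [← current_mode]; exact h1 _ (by omega)
    simp only [T]
    rw [h2 _ (by omega), hw]
    simp

lemma current_local (a b : sl2) : Local (current a) (current b) := by
  refine ⟨2, fun w => ?_⟩
  simp only [current_mode, op_comm]
  funext m n
  simp only [Function.iterate_succ, Function.iterate_zero, Function.comp_apply, id_eq, mulSub,
    Pi.zero_apply]
  have e1 : m + 1 + 1 + n = m + n + 2 := by ring
  have e2 : m + 1 + (n + 1) = m + n + 2 := by ring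
  have e3 : m + (n + 1 + 1) = m + n + 2 := by ring
  rw [e1, e2, e3]
  split_ifs
  · push_cast; module
  · simp

lemma current_local_Y (u : N) (b : sl2) : Local (current b) (Y u) := by
  let S : Submodule ℂ N :=
    { carrier := {u | ∀ b, Local (current b) (Y u)}
      zero_mem' := fun b => Local.of_commute fun m n w => by
        rw [map_zero, mode_zero, mode_zero, map_zero]
      add_mem' := fun {u v} hu hv b => by
        rw [map_add]; exact ((hu b).symm.add (hv b).symm).symm
      smul_mem' := fun r u hu b => by
        rw [map_smul]; exact ((hu b).symm.smul r).symm }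
  refine N_induction S ?_ ?_ u b
  · exact fun b => Local.of_commute fun m n w => by
      rw [Y_vac, idField_mode, idField_mode]; split_ifs <;> simp
  · intro a n u hu b
    rw [Y_op]
    exact (Local.resProd (hu a) (current_local a b) (hu b).symm n).symm

lemma Y_local (u v : N) : Local (Y u) (Y v) := by
  let S : Submodule ℂ N :=
    { carrier := {u | ∀ v, Local (Y u) (Y v)}
      zero_mem' := fun v => Local.of_commute fun m n w => by
        rw [map_zero, mode_zero, mode_zero, map_zero]
      add_mem' := fun {u u'} hu hu' v => by rw [map_add]; exact (hu v).add (hu' v)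
      smul_mem' := fun r u hu v => by rw [map_smul]; exact (hu v).smul r }
  refine N_induction S ?_ ?_ u v
  · exact fun b => Local.of_commute fun m n w => by
      rw [Y_vac, idField_mode, idField_mode]; split_ifs <;> simp
  · intro a n u hu v
    rw [Y_op]
    exact Local.resProd (current_local_Y u a) (current_local_Y v a) (hu v) n

/-- The vertex algebra `N(Λ₀)`. -/
def vertexN : VertexAlgebra N where
  Y := Y
  vac := vac
  vac_mode n w := by rw [Y_vac, idField_mode]
  creation u := (Y_creation u).1
  creation_nonneg u := (Y_creation u).2
  translation u n w := Y_translation u n w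
  locality := Y_local

/-- `Y(a(-1) 1, x) = a(x)`. -/
lemma Y_generator (a : sl2) : Y (op a (-1) vac) = current a := by
  refine field_ext fun k w => ?_
  obtain ⟨K, hK⟩ := trunc (current a) w
  rw [Y_op, Y_vac, resProd_apply_range (-1) k _ _ w (K + k.natAbs + 1)
    (fun i _ => hK _ (by omega)) (fun i _ => by rw [idField_mode, if_neg (by omega)])]
  have hb : ∀ i : ℕ, bc (-1) i = 1 := fun i => by
    induction i with
    | zero => exact bc_zero _
    | succ i ih =>
      have := bc_succ (-1) i
      rw [ih] at this
      have h0 : bc (-1 + 1) (i + 1) = 0 := by simp [bc, Ring.choose_zero_succ]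
      rw [h0] at this; linarith
  have hs : sg (-1) = -1 := by simp [sg]
  simp only [resTerm, hb, hs, one_smul, neg_smul, sub_neg_eq_add, idField_mode, current_mode]
  rcases lt_or_ge k 0 with h | h
  · rw [Finset.sum_eq_single (-1 - k).toNat]
    · rw [if_pos (by omega), if_neg (by omega), add_zero]
      congr 2; omega
    · intro i _ hi
      rw [if_neg (by omega), if_neg (by omega)]; simp
    · intro hi; exact absurd (Finset.mem_range.2 (by omega)) hi
  · rw [Finset.sum_eq_single k.toNat]
    · rw [if_neg (by omega), if_pos (by omega), map_zero, zero_add]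
      congr 2; omega
    · intro i _ hi
      rw [if_neg (by omega), if_neg (by omega)]; simp
    · intro hi; exact absurd (Finset.mem_range.2 (by omega)) hi

/-- For a set `S` of integers, the abelian subalgebra of `ĝ` spanned by the `x_α ⊗ t^m`, `m ∈ S`. -/
def nil (S : Set ℤ) : LieSubalgebra ℂ Affine :=
  { Submodule.span ℂ (loop xα '' S) with
    lie_mem' := by
      intro x y hx hy
      suffices h : ⁅x, y⁆ = 0 by rw [h]; exact Submodule.zero_mem _
      change x ∈ Submodule.span ℂ (loop xα '' S) at hx
      change y ∈ Submodule.span ℂ (loop xα '' S) at hy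
      induction hx using Submodule.span_induction with
      | zero => exact zero_lie _
      | add x x' _ _ hx hx' => rw [add_lie, hx, hx', add_zero]
      | smul r x _ hx => rw [smul_lie, hx, smul_zero]
      | mem x hx =>
        obtain ⟨m, _, rfl⟩ := hx
        induction hy using Submodule.span_induction with
        | zero => exact lie_zero _
        | add x x' _ _ hx hx' => rw [lie_add, hx, hx', add_zero]
        | smul r x _ hx => rw [lie_smul, hx, smul_zero]
        | mem y hy =>
          obtain ⟨n, _, rfl⟩ := hy
          have hf : form xα xα = 0 := by
            simp [form_apply, xα, Matrix.single_mul_single_of_ne]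
          rw [loop_bracket, lie_self, hf]
          have : loop 0 (m + n) = 0 := by
            have := loop_smul 0 0 (m + n)
            rwa [zero_smul, zero_smul] at this
          rw [this]; simp }

/-- The Lie algebra `n̄ = ℂ x_α ⊗ ℂ[t, t⁻¹]`. -/
abbrev nBar := nil Set.univ

/-- The Lie algebra `n̄_- = ℂ x_α ⊗ t⁻¹ ℂ[t⁻¹]`. -/
abbrev nMinus := nil (Set.Iic (-1))

/-- The action of `U(n)` on the highest weight vector, `a ↦ a · v`, for a subalgebra `n` of `ĝ`. -/
def actVac (n : LieSubalgebra ℂ Affine) : UniversalEnvelopingAlgebra ℂ n →ₗ[ℂ] N :=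
  (toN.restrictScalars ℂ).comp (UniversalEnvelopingAlgebra.lift ℂ
    ((UniversalEnvelopingAlgebra.ι ℂ).comp n.incl)).toLinearMap

lemma actVac_one (n : LieSubalgebra ℂ Affine) : actVac n 1 = vac := by
  change toN (UniversalEnvelopingAlgebra.lift ℂ _ 1) = _
  rw [map_one]; rfl

lemma actVac_ι_mul (n : LieSubalgebra ℂ Affine) (x : n) (u : UniversalEnvelopingAlgebra ℂ n) :
    actVac n (UniversalEnvelopingAlgebra.ι ℂ x * u) =
      UniversalEnvelopingAlgebra.ι ℂ (x : Affine) • actVac n u := by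
  change toN (UniversalEnvelopingAlgebra.lift ℂ _ _) = _
  rw [map_mul, toN_mul, UniversalEnvelopingAlgebra.lift_ι_apply]; rfl

/-- The principal subspace `W^N(Λ₀) = U(n̄) · v` of `N(Λ₀)`. -/
def W : Submodule ℂ N := LinearMap.range (actVac nBar)

lemma vac_mem_W : vac ∈ W := ⟨1, actVac_one _⟩

lemma loop_mem_nil {S : Set ℤ} {m : ℤ} (hm : m ∈ S) : loop xα m ∈ nil S :=
  Submodule.subset_span ⟨m, hm, rfl⟩

lemma op_mem_W (m : ℤ) {w : N} (hw : w ∈ W) : op xα m w ∈ W := by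
  obtain ⟨u, rfl⟩ := hw
  exact ⟨UniversalEnvelopingAlgebra.ι ℂ (⟨loop xα m, loop_mem_nil (Set.mem_univ m)⟩ : nBar) * u,
    actVac_ι_mul _ _ _⟩

lemma W_induction (S : Submodule ℂ N) (h1 : vac ∈ S) (hm : ∀ n, ∀ w ∈ W, w ∈ S → op xα n w ∈ S) :
    W ≤ S := by
  rintro _ ⟨u, rfl⟩
  refine (U_induction ((S ⊓ W).comap (actVac nBar)) ?_ (fun x v hv => ?_) u).1
  · rw [Submodule.mem_comap, actVac_one]; exact ⟨h1, vac_mem_W⟩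
  · rw [Submodule.mem_comap] at hv ⊢
    rw [actVac_ι_mul]
    obtain ⟨x, hx⟩ := x
    change x ∈ Submodule.span ℂ (loop xα '' Set.univ) at hx
    change UniversalEnvelopingAlgebra.ι ℂ x • _ ∈ _
    induction hx using Submodule.span_induction with
    | zero => rw [map_zero, zero_smul]; exact Submodule.zero_mem _
    | add x y _ _ hx hy => rw [map_add, add_smul]; exact Submodule.add_mem _ hx hy
    | smul r x _ hx => rw [map_smul, smul_assoc]; exact Submodule.smul_mem _ r hx
    | mem x hx =>
      obtain ⟨n, _, rfl⟩ := hx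
      exact ⟨hm n _ hv.2 hv.1, op_mem_W n hv.2⟩

lemma W_isSubalgebra : vertexN.IsSubalgebra W where
  vac_mem := vac_mem_W
  prod_mem u hu w hw n := by
    let S : Submodule ℂ N :=
      { carrier := {u | ∀ n : ℤ, ∀ w ∈ W, mode (Y u) n w ∈ W}
        zero_mem' := fun n w _ => by rw [map_zero, mode_zero]; exact W.zero_mem
        add_mem' := fun {u v} hu hv n w hw => by
          rw [map_add, mode_add]; exact W.add_mem (hu n w hw) (hv n w hw)
        smul_mem' := fun r u hu n w hw => by
          rw [map_smul, mode_smul]; exact W.smul_mem r (hu n w hw) }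
    refine W_induction S ?_ ?_ hu n w hw
    · intro n w hw
      rw [Y_vac, idField_mode]
      split_ifs
      · exact hw
      · exact W.zero_mem
    · intro n u _ hu k w hw
      obtain ⟨K1, h1⟩ := trunc (current xα) w
      obtain ⟨K2, h2⟩ := trunc (Y u) w
      rw [Y_op, resProd_apply_range n k _ _ w (K1 + K2 + k.natAbs) (fun i _ => h1 _ (by omega))
        (fun i _ => h2 _ (by omega))]
      refine W.sum_mem fun i _ => ?_
      rw [resTerm, current_mode, current_mode]
      exact zsmul_mem (W.sub_mem (op_mem_W _ (hu _ w hw))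
        (zsmul_mem (hu _ _ (op_mem_W _ hw)) _)) _

/-- The vertex algebra `W^N(Λ₀)`, a vertex subalgebra of `N(Λ₀)`. -/
def vertexW : VertexAlgebra W := vertexN.restrict W W_isSubalgebra

/-- The element `x_α(-1-j)` of `U(n̄_-)`, for a natural number `j`. -/
def xm (j : ℕ) : UniversalEnvelopingAlgebra ℂ nMinus :=
  UniversalEnvelopingAlgebra.ι ℂ
    (⟨loop xα (-1 - j), loop_mem_nil (by rw [Set.mem_Iic]; omega)⟩ : nMinus)

/-- The element `R⁰_t = ∑ x_α(m₁) x_α(m₂)` of `U(n̄_-)`, the sum over `m₁, m₂ ≤ -1` with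
`m₁ + m₂ = -t`, for `t = s + 2 ≥ 2`; here `m₁ = -1 - p.1`, `m₂ = -1 - p.2`. -/
def R (s : ℕ) : UniversalEnvelopingAlgebra ℂ nMinus :=
  ∑ p ∈ Finset.HasAntidiagonal.antidiagonal s, xm p.1 * xm p.2

/-- The left ideal `I_{Λ₀} = ∑_{t ≥ 2} U(n̄_-) R⁰_t` of `U(n̄_-)`. -/
def idealI : Submodule (UniversalEnvelopingAlgebra ℂ nMinus) (UniversalEnvelopingAlgebra ℂ nMinus) :=
  Submodule.span _ (Set.range R)

/-- The subspace `I_{Λ₀} · v` of `N(Λ₀)`. -/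
def idealIVac : Submodule ℂ N := (idealI.restrictScalars ℂ).map (actVac nMinus)

/-- The vector `x_α(-1)² · v` of `W^N(Λ₀)`. -/
def nullVector : W := ⟨op xα (-1) (op xα (-1) vac), op_mem_W _ (op_mem_W _ vac_mem_W)⟩

end AffineSl2
end

noncomputable section
namespace AffineSl2
open VA
attribute [local instance 100] LieRing.ofAssociativeRing
attribute [local instance 100] LieAlgebra.ofAssociativeAlgebra

/-! Everything rests on `n̄` acting on `W^N(Λ₀)` by commuting operators. The `x_α(m)` commute with
each other, since `[x_α, x_α] = 0` and `tr(x_α²) = 0`, and for `m ≥ 0` they kill the vacuum; hence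
they kill all of `W^N(Λ₀) = U(n̄) · v` (`op_nonneg_W`). On the principal subspace the residue
product therefore loses its second half, and the modes of `Y(x_α(n) u, x)` are combinations of
`x_α(n - i)` composed with modes of `Y(u, x)` (`mode_Y_op_W`).

In particular `x_α(-1)² v` has vertex operator `x_α(x)²` on `W^N(Λ₀)`, and its mode of index `-1 -
s` is the action of `R⁰_{s+2}` (`mode_Y_nullVector`).

The generated ideal contains `I · v`: applying these modes to the vacuum gives every `R⁰_{s+2} v`,
and an ideal is stable under each `x_α(n)`, which is a mode of `x_α(-1) v`.

Conversely, `I · v` contains `x_α(-1)² v = R⁰_2 v`, so it suffices that it is an ideal. Products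
`u_n w` with `w` in `I · v` are handled by induction on `u` in `W^N(Λ₀)`, because `I · v` is stable
under all `x_α(n)`. Products `w_n u` are handled by induction on `w`, which reduces to `w = R⁰_{s+2}
v`. For `s = 0` the modes are the operators `R⁰_t` or zero, and each `R⁰_t` maps `W^N(Λ₀)` into `I ·
v` by commutativity. For larger `s` the translation operator is used: `D R⁰_{s+2} v = (s + 1)
R⁰_{s+3} v` (`transl_actR_vac`), while `Y(D u, x)` is the derivative of `Y(u, x)` (`mode_Y_transl`),
so the modes of each generator are multiples of modes of the previous one. -/

/-! ### Commuting operators on the principal subspace -/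

/-- Both terms of the affine bracket vanish: `[x_α, x_α] = 0`, and the central term carries the
factor `tr(x_α²) = 0`. -/
lemma op_xα_comm (m n : ℤ) (w : N) : op xα m (op xα n w) = op xα n (op xα m w) := by
  have hf : form xα xα = 0 := by simp [form_apply, xα, Matrix.single_mul_single_of_ne]
  have h0 : loop 0 (m + n) = 0 := by
    have := loop_smul 0 0 (m + n)
    rwa [zero_smul, zero_smul] at this
  have h := op_comm xα xα m n w
  rw [lie_self, hf, mul_zero, zero_smul, ite_self, add_zero, op_apply 0, h0, map_zero,
    zero_smul] at h
  exact sub_eq_zero.1 h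

/-- The operators `x_α(m)`, `m ≥ 0`, annihilate the principal subspace. -/
lemma op_nonneg_W {m : ℤ} (hm : 0 ≤ m) {w : N} (hw : w ∈ W) : op xα m w = 0 := by
  -- The kernel of `x_α(m)` contains the vacuum and, by commutativity, is stable under every
  -- `x_α(n)`.
  have : W ≤ LinearMap.ker (op xα m) := W_induction _ (op_vac _ _ hm) fun n w _ h => by
    rw [LinearMap.mem_ker] at h ⊢
    rw [op_xα_comm, h, map_zero]
  exact this hw

/-- On the principal subspace only the first half of the residue product survives. -/
lemma mode_Y_op_W (n k : ℤ) (u : N) {w : N} (hw : w ∈ W) (K : ℕ)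
    (h : ∀ i : ℕ, K ≤ i → mode (Y u) (k + i) w = 0) :
    mode (Y (op xα n u)) k w =
      ∑ i ∈ Finset.range K, bc n i • op xα (n - i) (mode (Y u) (k + i) w) := by
  -- The second half of the residue product applies `x_α(i)` with `i ≥ 0` directly to `w`, so it
  -- vanishes term by term.
  rw [Y_op, resProd_apply_range n k _ _ w K
    (fun i _ => by rw [current_mode, op_nonneg_W (by omega) hw]) h]
  refine Finset.sum_congr rfl fun i _ => ?_
  rw [resTerm, current_mode, current_mode, op_nonneg_W (by omega) hw, map_zero, smul_zero, sub_zero]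

/-! ### Vertex operators of translated vectors -/

/-- Coefficient form of `(d/dx) (t - x)^n = -n (t - x)^(n-1)`; this is what makes the product rule
work in `mode_Y_transl`. -/
lemma bc_succ_mul (n : ℤ) (i : ℕ) : bc n (i + 1) * ((i + 1 : ℕ) : ℤ) = -(n * bc (n - 1) i) := by
  have h1 := bc_mul n i
  have h2 := choose_mul_sub n i
  have h3 : bc n i * (n - i) = n * bc (n - 1) i := by
    simp only [bc]; linear_combination (-1) ^ i * h2
  push_cast
  linarith

/-- `Y(D u, x) = (d/dx) Y(u, x)` on the principal subspace. -/
lemma mode_Y_transl {u : N} (hu : u ∈ W) (k : ℤ) {w : N} (hw : w ∈ W) :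
    mode (Y (transl u)) k w = -(k • mode (Y u) (k - 1) w) := by
  let S : Submodule ℂ N :=
    { carrier := {u | ∀ (k : ℤ), ∀ w ∈ W, mode (Y (transl u)) k w = -(k • mode (Y u) (k - 1) w)}
      zero_mem' := fun k w _ => by
        rw [map_zero, map_zero, mode_zero, mode_zero, smul_zero, neg_zero]
      add_mem' := fun {u v} hu hv k w hw => by
        rw [map_add, map_add, map_add, mode_add, mode_add, hu k w hw, hv k w hw, smul_add, neg_add]
      smul_mem' := fun r u hu k w hw => by
        rw [map_smul, map_smul, map_smul, mode_smul, mode_smul, hu k w hw, smul_neg,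
          smul_comm r k] }
  refine (?_ : W ≤ S) hu k w hw
  refine W_induction S ?_ ?_
  · intro k w _
    rw [transl_apply, Y_vac, idField_mode, if_neg (by omega), map_zero, mode_zero, idField_mode]
    -- `D` kills the vacuum, so the left side is zero. On the right the identity field contributes
    -- only when `k - 1 = -1`, and there the factor `k` is zero.
    split_ifs with h
    · have : k = 0 := by omega
      simp [this]
    · simp
  · intro n u _ hu k w hw
    have hu' : ∀ (k : ℤ), ∀ w ∈ W, mode (Y (transl u)) k w = -(k • mode (Y u) (k - 1) w) := hu
    obtain ⟨L, hL⟩ := trunc (Y u) w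
    set K := L + k.natAbs + 1 with hK
    have hz : ∀ j : ℤ, L ≤ j → mode (Y u) j w = 0 := hL
    -- Start from `D x_α(n) u = x_α(n) D u - n x_α(n-1) u` and expand all three vertex operators.
    -- The sums for `x_α(n) D u` and for the right side run over one more index, so that removing
    -- their `i = 0` terms leaves sums involving `x_α(n-1-i)`, aligned with the sum for `x_α(n-1)
    -- u`.
    rw [transl_op, map_sub, map_zsmul, sub_eq_add_neg, ← neg_smul, mode_add,
      ← Int.cast_smul_eq_zsmul ℂ, mode_smul, Int.cast_smul_eq_zsmul,
      mode_Y_op_W n k _ hw (K + 1) (fun i _ => by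
        rw [hu' _ _ hw, hz _ (by omega), smul_zero, neg_zero]),
      mode_Y_op_W (n - 1) k _ hw K (fun i _ => hz _ (by omega)),
      mode_Y_op_W n (k - 1) _ hw (K + 1) (fun i _ => hz _ (by omega)),
      Finset.sum_range_succ', Finset.sum_range_succ' _ K, Finset.smul_sum, smul_add,
      Finset.smul_sum, neg_add, ← Finset.sum_neg_distrib, add_right_comm, ← Finset.sum_add_distrib]
    congr 1
    · refine Finset.sum_congr rfl fun i _ => ?_
      -- The inductive hypothesis at mode `k + i + 1` produces the factor `-(k + i + 1)` where the
      -- right side has `-k`; the excess `-(i + 1) bc n (i + 1)` cancels against `-n bc (n - 1) i`.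
      have hb := bc_succ_mul n i
      rw [hu' _ _ hw, map_neg, map_zsmul]
      have e1 : n - ((i + 1 : ℕ) : ℤ) = n - 1 - i := by push_cast; ring
      have e2 : k + ((i + 1 : ℕ) : ℤ) - 1 = k + i := by push_cast; ring
      have e3 : k - 1 + ((i + 1 : ℕ) : ℤ) = k + i := by push_cast; ring
      rw [e1, e2, e3, smul_neg, smul_smul, smul_smul, smul_smul, ← neg_smul, ← neg_smul, ← add_smul]
      congr 1
      linear_combination -hb
    · rw [hu' _ _ hw]
      simp [bc_zero]

/-! ### The quadratic operators and the subspace `I · v` -/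

/-- The operator by which `R⁰_{s+2}` acts on `N(Λ₀)`. -/
def actR (s : ℕ) : Module.End ℂ N :=
  ∑ p ∈ Finset.HasAntidiagonal.antidiagonal s, op xα (-1 - p.1) * op xα (-1 - p.2)

lemma actR_apply (s : ℕ) (w : N) : actR s w =
    ∑ p ∈ Finset.HasAntidiagonal.antidiagonal s, op xα (-1 - p.1) (op xα (-1 - p.2) w) := by
  simp [actR, LinearMap.sum_apply]

lemma actR_op (s : ℕ) (n : ℤ) (w : N) : actR s (op xα n w) = op xα n (actR s w) := by
  simp only [actR_apply, map_sum]
  refine Finset.sum_congr rfl fun p _ => ?_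
  rw [op_xα_comm _ n, op_xα_comm _ n]

lemma actVac_xm_mul (j : ℕ) (u : UniversalEnvelopingAlgebra ℂ nMinus) :
    actVac nMinus (xm j * u) = op xα (-1 - j) (actVac nMinus u) :=
  actVac_ι_mul _ _ _

lemma actVac_R (s : ℕ) : actVac nMinus (R s) = actR s vac := by
  rw [actR_apply, R, map_sum]
  refine Finset.sum_congr rfl fun p _ => ?_
  rw [actVac_xm_mul, ← mul_one (xm p.2), actVac_xm_mul, actVac_one]

lemma actR_vac_mem (s : ℕ) : actR s vac ∈ idealIVac :=
  ⟨R s, Submodule.subset_span ⟨s, rfl⟩, actVac_R s⟩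

/-- Induction principle for `I · v`, used three times: for its inclusion in `W`, for the products
`w_n u`, and for its inclusion in the generated ideal. A left ideal is spanned by the products `u
R⁰_t`, and `U(n̄_-)` is generated by the `x_α(n)` with `n ≤ -1`. -/
lemma idealIVac_induction (S : Submodule ℂ N) (hR : ∀ s, actR s vac ∈ S)
    (hm : ∀ n, ∀ w ∈ S, op xα n w ∈ S) : idealIVac ≤ S := by
  rintro _ ⟨r, hr, rfl⟩
  change r ∈ Submodule.span _ (Set.range R) at hr
  induction hr using Submodule.span_induction with
  | zero => rw [map_zero]; exact S.zero_mem
  | add x y _ _ hx hy => rw [map_add]; exact S.add_mem hx hy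
  | mem x hx => obtain ⟨s, rfl⟩ := hx; rw [actVac_R]; exact hR s
  | smul u r _ hr =>
    -- With `r` fixed, the `u` for which `u r v` lies in `S` form a subspace that contains `1` and
    -- is stable under left multiplication by generators.
    refine U_induction (S.comap ((actVac nMinus).comp (LinearMap.mulRight ℂ r))) ?_ ?_ u
    · simpa using hr
    · intro x v hv
      simp only [Submodule.mem_comap, LinearMap.comp_apply, LinearMap.mulRight_apply] at hv ⊢
      rw [mul_assoc, actVac_ι_mul]
      obtain ⟨x, hx⟩ := x
      change x ∈ Submodule.span ℂ (loop xα '' Set.Iic (-1)) at hx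
      change UniversalEnvelopingAlgebra.ι ℂ x • _ ∈ _
      induction hx using Submodule.span_induction with
      | zero => rw [map_zero, zero_smul]; exact S.zero_mem
      | add x y _ _ hx hy => rw [map_add, add_smul]; exact S.add_mem hx hy
      | smul r x _ hx => rw [map_smul, smul_assoc]; exact S.smul_mem r hx
      | mem x hx => obtain ⟨n, _, rfl⟩ := hx; exact hm n _ hv

lemma actR_mem_W (s : ℕ) {w : N} (hw : w ∈ W) : actR s w ∈ W := by
  rw [actR_apply]
  exact W.sum_mem fun p _ => op_mem_W _ (op_mem_W _ hw)

lemma idealIVac_le_W : idealIVac ≤ W :=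
  idealIVac_induction W (fun s => actR_mem_W s vac_mem_W) fun n _ hw => op_mem_W n hw

/-- For `n < 0` this is the left ideal property of `I`; for `n ≥ 0` the result is zero, since `I ·
v` lies in `W`. Thus `I · v`, defined through `n̄_-` alone, is stable under all of `n̄`. -/
lemma op_mem_idealIVac (n : ℤ) {w : N} (hw : w ∈ idealIVac) : op xα n w ∈ idealIVac := by
  rcases le_or_gt 0 n with h | h
  · rw [op_nonneg_W h (idealIVac_le_W hw)]; exact idealIVac.zero_mem
  · obtain ⟨r, hr, rfl⟩ := hw
    exact ⟨UniversalEnvelopingAlgebra.ι ℂ (⟨loop xα n, loop_mem_nil (by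
      rw [Set.mem_Iic]; omega)⟩ : nMinus) * r, idealI.smul_mem _ hr, actVac_ι_mul _ _ _⟩

/-- By commutativity `R⁰_t` can be moved past any element of `U(n̄)` until it meets the vacuum, so
`R⁰_t U(n̄) v = U(n̄) R⁰_t v`. -/
lemma actR_mem_idealIVac (s : ℕ) {w : N} (hw : w ∈ W) : actR s w ∈ idealIVac := by
  refine (W_induction (idealIVac.comap (actR s)) (actR_vac_mem s) fun n w _ h => ?_) hw
  rw [Submodule.mem_comap] at h ⊢
  rw [actR_op]
  exact op_mem_idealIVac n h

/-! ### Modes of the square of the current -/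

lemma bc_neg_one (i : ℕ) : bc (-1) i = 1 := by
  induction i with
  | zero => exact bc_zero _
  | succ i ih =>
    have h := bc_succ (-1) i
    have h0 : bc (-1 + 1) (i + 1) = 0 := by simp [bc, Ring.choose_zero_succ]
    rw [ih, h0] at h
    linarith

lemma actR_zero_vac : actR 0 vac = op xα (-1) (op xα (-1) vac) := by simp [actR_apply]

/-- The modes of `x_α(x)²` on the principal subspace. -/
lemma mode_Y_nullVector (k : ℤ) {w : N} (hw : w ∈ W) :
    mode (Y (actR 0 vac)) k w = if k < 0 then actR (-1 - k).toNat w else 0 := by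
  rw [actR_zero_vac]
  split_ifs with hk
  · obtain ⟨s, rfl⟩ : ∃ s : ℕ, k = -1 - s := ⟨(-1 - k).toNat, by omega⟩
    -- For `i > s` the inner mode index `-1 - s + i` is nonnegative and kills `w`. The terms `i ≤ s`
    -- are `x_α(-1-i) x_α(-1-(s-i))`, exactly those of `R⁰_{s+2}`.
    rw [mode_Y_op_W (-1) _ _ hw (s + 1) (fun i hi => by
      rw [Y_generator, current_mode, op_nonneg_W (by omega) hw]),
      show (-1 - (-1 - (s : ℤ))).toNat = s by omega, actR_apply,
      Finset.Nat.sum_antidiagonal_eq_sum_range_succ_mk]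
    refine Finset.sum_congr rfl fun i hi => ?_
    rw [Finset.mem_range] at hi
    rw [bc_neg_one, one_smul, Y_generator, current_mode]
    dsimp only
    rw [show (-1 - (s : ℤ) + i) = -1 - ((s - i : ℕ) : ℤ) by omega]
  -- For `k ≥ 0` every inner index `k + i` is nonnegative, so the sum can be cut off at the start.
  · rw [mode_Y_op_W (-1) _ _ hw 0 (fun i hi => by
      rw [Y_generator, current_mode, op_nonneg_W (by omega) hw]), Finset.sum_range_zero]

/-! ### Translation of the generators -/

lemma transl_vac : transl vac = 0 := by
  rw [transl_apply, Y_vac, idField_mode, if_neg (by omega)]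

/-- `D` kills the vacuum and satisfies the Leibniz rule with `[D, x_α(-1-i)] = (i + 1) x_α(-2-i)`. A
monomial `x_α(-1-i) x_α(-1-j)` with `i + j = s + 1` is reached by raising either factor, with
weights `i` and `j`, whose sum is `s + 1`. -/
lemma transl_actR_vac (s : ℕ) : transl (actR s vac) = ((s : ℤ) + 1) • actR (s + 1) vac := by
  let f : ℕ → ℕ → N := fun i j => op xα (-1 - i) (op xα (-1 - j) vac)
  have h1 : transl (actR s vac) = ∑ p ∈ Finset.HasAntidiagonal.antidiagonal s,
      ((p.1 : ℤ) + 1) • f (p.1 + 1) p.2 + ∑ p ∈ Finset.HasAntidiagonal.antidiagonal s,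
      ((p.2 : ℤ) + 1) • f p.1 (p.2 + 1) := by
    rw [actR_apply, map_sum, ← Finset.sum_add_distrib]
    refine Finset.sum_congr rfl fun p _ => ?_
    simp only [f, transl_op, transl_vac, map_zero, zero_sub, map_neg, map_zsmul]
    have e : ∀ i : ℕ, (-1 : ℤ) - ((i + 1 : ℕ) : ℤ) = -1 - i - 1 := fun i => by push_cast; ring
    rw [e, e]
    module
  -- The shifted sum misses only the term with first index `0`, whose weight is zero; `h3` is the
  -- mirror image.
  have h2 : ∑ p ∈ Finset.HasAntidiagonal.antidiagonal s, ((p.1 : ℤ) + 1) • f (p.1 + 1) p.2 =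
      ∑ p ∈ Finset.HasAntidiagonal.antidiagonal (s + 1), (p.1 : ℤ) • f p.1 p.2 := by
    rw [Finset.Nat.sum_antidiagonal_succ]; simp
  have h3 : ∑ p ∈ Finset.HasAntidiagonal.antidiagonal s, ((p.2 : ℤ) + 1) • f p.1 (p.2 + 1) =
      ∑ p ∈ Finset.HasAntidiagonal.antidiagonal (s + 1), (p.2 : ℤ) • f p.1 p.2 := by
    rw [Finset.Nat.sum_antidiagonal_succ']; simp
  rw [h1, h2, h3, ← Finset.sum_add_distrib, actR_apply, Finset.smul_sum]
  refine Finset.sum_congr rfl fun p hp => ?_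
  rw [← add_smul]
  congr 1
  rw [← Nat.cast_add, Finset.HasAntidiagonal.mem_antidiagonal.1 hp]
  push_cast
  rfl

/-- On `W`, `s + 1` times the `k`-th mode of `R⁰_{s+3} v` is `-k` times the `(k-1)`-st mode of
`R⁰_{s+2} v`. Since `s + 1` is invertible in `ℂ`, everything descends to `s = 0`, where the modes
are known. The mode index drops at each step, so the induction must allow all `k`. -/
lemma mode_Y_actR_vac_mem (s : ℕ) (k : ℤ) {w : N} (hw : w ∈ W) :
    mode (Y (actR s vac)) k w ∈ idealIVac := by
  induction s generalizing k with
  | zero =>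
    rw [mode_Y_nullVector k hw]
    split_ifs
    · exact actR_mem_idealIVac _ hw
    · exact idealIVac.zero_mem
  | succ s ih =>
    have hs : ((s : ℂ) + 1) ≠ 0 := by exact_mod_cast s.succ_ne_zero
    have h := mode_Y_transl (actR_mem_W s vac_mem_W) k hw
    rw [transl_actR_vac, ← Int.cast_smul_eq_zsmul ℂ, map_smul, mode_smul] at h
    push_cast at h
    rw [← (Submodule.smul_mem_iff idealIVac hs), h]
    exact idealIVac.neg_mem (zsmul_mem (ih (k - 1)) k)

/-! ### The ideal property of `I · v` -/

/-- The common inductive step for products on both sides: by `mode_Y_op_W` the new modes are the old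
ones followed by operators `x_α(n - i)`, which preserve `I · v`. -/
lemma mode_Y_op_mem_idealIVac (n k : ℤ) (u : N) {w : N} (hw : w ∈ W)
    (h : ∀ k, mode (Y u) k w ∈ idealIVac) : mode (Y (op xα n u)) k w ∈ idealIVac := by
  obtain ⟨L, hL⟩ := trunc (Y u) w
  rw [mode_Y_op_W n k u hw (L + k.natAbs) (fun i _ => hL _ (by omega))]
  exact idealIVac.sum_mem fun i _ => zsmul_mem (op_mem_idealIVac _ (h _)) _

lemma mode_Y_left_mem (w : N) (hw : w ∈ idealIVac) (u : N) (hu : u ∈ W) (n : ℤ) :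
    mode (Y u) n w ∈ idealIVac := by
  let S : Submodule ℂ N :=
    { carrier := {u | ∀ n : ℤ, mode (Y u) n w ∈ idealIVac}
      zero_mem' := fun n => by rw [map_zero, mode_zero]; exact idealIVac.zero_mem
      add_mem' := fun {u v} hu hv n => by
        rw [map_add, mode_add]; exact idealIVac.add_mem (hu n) (hv n)
      smul_mem' := fun r u hu n => by rw [map_smul, mode_smul]; exact idealIVac.smul_mem r (hu n) }
  refine W_induction S (fun n => ?_) (fun m u _ hu n => ?_) hu n
  · rw [Y_vac, idField_mode]
    split_ifs
    · exact hw
    · exact idealIVac.zero_mem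
  · exact mode_Y_op_mem_idealIVac m n u (idealIVac_le_W hw) hu

lemma mode_Y_right_mem (u : N) (hu : u ∈ idealIVac) (w : N) (hw : w ∈ W) (n : ℤ) :
    mode (Y u) n w ∈ idealIVac := by
  let S : Submodule ℂ N :=
    { carrier := {u | ∀ n : ℤ, mode (Y u) n w ∈ idealIVac}
      zero_mem' := fun n => by rw [map_zero, mode_zero]; exact idealIVac.zero_mem
      add_mem' := fun {u v} hu hv n => by
        rw [map_add, mode_add]; exact idealIVac.add_mem (hu n) (hv n)
      smul_mem' := fun r u hu n => by rw [map_smul, mode_smul]; exact idealIVac.smul_mem r (hu n) }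
  exact idealIVac_induction S (fun s k => mode_Y_actR_vac_mem s k hw)
    (fun m u hu k => mode_Y_op_mem_idealIVac m k u hw hu) hu n

lemma vertexW_prod (u v : W) (n : ℤ) : (vertexW.prod u n v : N) = mode (Y u) n v :=
  vertexN.restrict_prod W W_isSubalgebra u v n

lemma isIdeal_idealIVac : vertexW.IsIdeal (idealIVac.comap W.subtype) where
  left_mem v w hw n := by
    rw [Submodule.mem_comap, Submodule.subtype_apply] at hw ⊢
    rw [vertexW_prod]
    exact mode_Y_left_mem w hw v v.2 n
  right_mem v w hw n := by
    rw [Submodule.mem_comap, Submodule.subtype_apply] at hw ⊢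
    rw [vertexW_prod]
    exact mode_Y_right_mem w hw v v.2 n

/-! ### The generated ideal contains `I · v` -/

lemma actR_vac_mem_idealSpan (s : ℕ) :
    actR s vac ∈ (vertexW.idealSpan {nullVector}).map W.subtype := by
  -- The mode of index `-1 - s` of `x_α(x)²` acts on `W` as `R⁰_{s+2}`; here it is applied to the
  -- vacuum.
  refine ⟨vertexW.prod nullVector (-1 - s) ⟨vac, vac_mem_W⟩,
    (vertexW.idealSpan_isIdeal _).right_mem _ _
      (vertexW.subset_idealSpan _ (Set.mem_singleton _)) _, ?_⟩
  have h := mode_Y_nullVector (-1 - s) vac_mem_W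
  rw [if_pos (by omega), show (-1 - (-1 - (s : ℤ))).toNat = s by omega, actR_zero_vac] at h
  exact (vertexW_prod _ _ _).trans h

lemma op_mem_idealSpan (n : ℤ) (w : N)
    (hw : w ∈ (vertexW.idealSpan {nullVector}).map W.subtype) :
    op xα n w ∈ (vertexW.idealSpan {nullVector}).map W.subtype := by
  obtain ⟨w, hw, rfl⟩ := hw
  -- The operator `x_α(n)` is itself a mode of an element of `W`, namely of `x_α(-1) v`.
  refine ⟨vertexW.prod ⟨op xα (-1) vac, op_mem_W _ vac_mem_W⟩ n w,
    (vertexW.idealSpan_isIdeal _).left_mem _ _ hw _, ?_⟩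
  refine (vertexW_prod _ _ _).trans ?_
  rw [Y_generator, current_mode]
  rfl

end AffineSl2
end

theorem mainTheorem3 :
    AffineSl2.idealIVac =
      (AffineSl2.vertexW.idealSpan {AffineSl2.nullVector}).map AffineSl2.W.subtype := by
  refine le_antisymm (AffineSl2.idealIVac_induction _ AffineSl2.actR_vac_mem_idealSpan
    AffineSl2.op_mem_idealSpan) (Submodule.map_le_iff_le_comap.2 (sInf_le
      ⟨AffineSl2.isIdeal_idealIVac, Set.singleton_subset_iff.2 ?_⟩))
  -- By minimality of the generated ideal it remains to place the generator in `I · v`, and it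
  -- equals `R⁰_2 v`.
  have h := AffineSl2.actR_vac_mem 0
  rwa [AffineSl2.actR_zero_vac] at h
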